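/- **Game.** Let $G=(V,E)$ be a finite directed graph whose edges $e$ have transit times $\tau_e>0$ and capacities $\nu_e>0$; write $\delta_v^+$, $\delta_v^-$ for the sets of edges leaving and entering $v$. Let $P$ be a finite set of players; player $j$ has an origin $s_j$, a destination $t_j\ne s_j$ reachable from $s_j$, and a supply rate $d_j>0$. Let $H>0$ be the time horizon. **Feasible flows over time.** A *feasible flow over time* consists of Lebesgue-integrable inflow rates $f^+_{e,j}:[0,H)\to\mathbb{R}_{\ge 0}$ and outflow rates $f^-_{e,j}:[0,H+\tau_e)\to\mathbb{R}_{\ge 0}$ ($e\in E$, $j\in P$) satisfying (1)–(4) below. Here $F^{\pm}_{e,j}(\theta)=\int_0^\theta f^{\pm}_{e,j}$ (and $F^\pm_{e,j}(\theta)=0$, $f^+_{e,j}(\theta)=0$ for $\theta<0$), $z_e(\theta)=\sum_j F^+_{e,j}(\theta)-\sum_j F^-_{e,j}(\theta+\tau_e)$ is the queue length, and $T_e(\theta)=\theta+z_e(\theta)/\nu_e+\tau_e$ is the exit time, for $\theta<H$. Equations between rates are understood for almost every time in the indicated interval. 1. Flow conservation, $\theta\in[0,H)$: for all $j$ and all $v\neq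 t_j$, $\sum_{e\in\delta^+_v}f^+_{e,j}(\theta)-\sum_{e\in\delta^-_v}f^-_{e,j}(\theta)$ equals $d_j$ if $v=s_j$ and $0$ otherwise. 2. Non-deficit: $F^+_{e,j}(\theta)-F^-_{e,j}(\theta+\tau_e)\ge 0$ for all $\theta\in[0,H)$. 3. Operation at capacity, $\theta\in[0,H)$: $\sum_j f^-_{e,j}(\theta+\tau_e)$ equals $\nu_e$ if $z_e(\theta)>0$, and $\min\{\sum_j f^+_{e,j}(\theta),\nu_e\}$ otherwise. 4. Fluid merging, $\theta\in[0,H+\tau_e)$: $\phi=\max T_e^{-1}(\theta)$ exists, and $f^-_{e,j}(\theta)=\frac{f^+_{e,j}(\phi)}{\sum_{j'}f^+_{e,j'}(\phi)}\sum_{j'}f^-_{e,j'}(\theta)$ if $\sum_{j'}f^+_{e,j'}(\phi)>0$, and $f^-_{e,j}(\theta)=0$ otherwise. **Strategies.** Let $\mathcal I=[0,H)\times\mathbb{R}_{\ge0}^E$. A strategy of player $j$ is a Lebesgue-measurable function $g_j=(g_{e,j})_{e\in E}:\mathcal I\to[0,1]^E$ with $\sum_{e\in\delta_v^+}g_{e,j}(I)=1$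 for all $I\in\mathcal I$ and $v\in V\setminus\{t_j\}$. It is *right-Lipschitz* if every $g_{e,j}$ is locally Lipschitz-continuous from the right: for every $I\in\mathcal I$ there are $L,\varepsilon>0$ such that $|g_{e,j}(I+x)-g_{e,j}(I+y)|\le L\|x-y\|$ for all $x,y\in[0,\varepsilon]\times[0,\varepsilon]^E$ with $I+x,I+y\in\mathcal I$. **Theorem.** For every profile $g=(g_j)_{j\in P}$ of right-Lipschitz strategies there exists a unique (up to null sets) feasible flow over time that satisfies, with $T(\theta)=(T_e(\theta))_{e\in E}$ and for all $j\in P$ and almost every $\theta\in[0,H)$, $$f^+_{e,j}(\theta)=g_{e,j}(\theta,T(\theta))\Big(\sum_{e'\in\delta^-_{s_j}}f^-_{e',j}(\theta)+d_j\Big)\ \text{ for } e\in\delta^+_{s_j},$$ $$f^+_{e,j}(\theta)=g_{e,j}(\theta,T(\theta))\sum_{e'\in\delta^-_{u}}f^-_{e',j}(\theta)\ \text{ for } e\in\delta^+_u,\ u\notin\{s_j,t_j\},$$ $$f^+_{e,j}(\theta)=0\ \text{ for } e\in\delta^+_{t_j}.$$ -/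

import Mathlib

open MeasureTheory

noncomputable section

namespace FlowOverTime

/-- An atomic splittable flow over time game, with nodes `V`, edges `E` (parallel edges are allowed)
and players `P`. -/
structure Game (V E P : Type*) where
  /-- start node of an edge -/
  tail : E → V
  /-- end node of an edge -/
  head : E → V
  /-- transit times -/
  τ : E → ℝ
  τ_pos : ∀ e, 0 < τ e
  /-- capacities -/
  ν : E → ℝ
  ν_pos : ∀ e, 0 < ν e
  /-- origins -/
  s : P → V
  /-- destinations -/
  t : P → V
  s_ne_t : ∀ j, s j ≠ t j
  /-- supply rates -/
  d : P → ℝ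
  d_pos : ∀ j, 0 < d j
  /-- time horizon -/
  H : ℝ
  H_pos : 0 < H
  /-- every destination is reachable from the corresponding origin along a directed path -/
  reachable : ∀ j, Relation.ReflTransGen (fun u v => ∃ e, tail e = u ∧ head e = v) (s j) (t j)

/-- Inflow and outflow rates. Only the values of `inflow e j` on `[0, H)` and of `outflow e j` on
`[0, H + τ e)` are relevant. -/
structure Rates (E P : Type*) where
  /-- `inflow e j θ` is the rate at which flow of player `j` enters edge `e` at time `θ` -/
  inflow : E → P → ℝ → ℝ
  /-- `outflow e j θ` is the rate at which flow of player `j` leaves edge `e` at time `θ` -/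
  outflow : E → P → ℝ → ℝ

/-- Cumulative flow up to time `θ`; it is `0` for `θ < 0`. -/
def cumulative (r : ℝ → ℝ) (θ : ℝ) : ℝ := ∫ x in Set.Ioc 0 θ, r x

namespace Game

variable {V E P : Type*} (G : Game V E P)

/-- Edges leaving `v`. -/
def outEdges [Fintype E] [DecidableEq V] (v : V) : Finset E :=
  Finset.univ.filter fun e => G.tail e = v

/-- Edges entering `v`. -/
def inEdges [Fintype E] [DecidableEq V] (v : V) : Finset E :=
  Finset.univ.filter fun e => G.head e = v

/-- Queue length of edge `e` at time `θ`. -/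
def queue [Fintype P] (f : Rates E P) (e : E) (θ : ℝ) : ℝ :=
  ∑ j, cumulative (f.inflow e j) θ - ∑ j, cumulative (f.outflow e j) (θ + G.τ e)

/-- Exit time of a particle that enters edge `e` at time `θ`. -/
def exitTime [Fintype P] (f : Rates E P) (e : E) (θ : ℝ) : ℝ :=
  θ + G.queue f e θ / G.ν e + G.τ e

/-- Inflow rate, set to `0` at negative times. -/
def inflowExt (f : Rates E P) (e : E) (j : P) (φ : ℝ) : ℝ :=
  if 0 ≤ φ then f.inflow e j φ else 0

/-- Feasible flows over time. Rates are Lebesgue-integrable functions, hence equations between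
rates are required at almost every time. The outflow rates are considered until `H + τ e`, since
the queue length at time `θ` involves the outflow up to time `θ + τ e`. -/
structure IsFeasible [Fintype E] [Fintype P] [DecidableEq V] (f : Rates E P) : Prop where
  inflow_nonneg : ∀ e j, ∀ θ ∈ Set.Ico 0 G.H, 0 ≤ f.inflow e j θ
  outflow_nonneg : ∀ e j, ∀ θ ∈ Set.Ico 0 (G.H + G.τ e), 0 ≤ f.outflow e j θ
  inflow_integrable : ∀ e j, IntegrableOn (f.inflow e j) (Set.Ico 0 G.H)
  outflow_integrable : ∀ e j, IntegrableOn (f.outflow e j) (Set.Ico 0 (G.H + G.τ e))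
  /-- flow conservation at the origin -/
  conservation_source : ∀ j, ∀ᵐ θ ∂volume.restrict (Set.Ico 0 G.H),
    ∑ e ∈ G.outEdges (G.s j), f.inflow e j θ - ∑ e ∈ G.inEdges (G.s j), f.outflow e j θ = G.d j
  /-- flow conservation at all nodes but the origin and the destination -/
  conservation : ∀ j v, v ≠ G.s j → v ≠ G.t j → ∀ᵐ θ ∂volume.restrict (Set.Ico 0 G.H),
    ∑ e ∈ G.outEdges v, f.inflow e j θ - ∑ e ∈ G.inEdges v, f.outflow e j θ = 0
  /-- non-deficit constraints -/
  non_deficit : ∀ e j, ∀ θ ∈ Set.Ico 0 G.H,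
    0 ≤ cumulative (f.inflow e j) θ - cumulative (f.outflow e j) (θ + G.τ e)
  /-- edges operate at capacity while there is a queue -/
  capacity : ∀ e, ∀ᵐ θ ∂volume.restrict (Set.Ico 0 G.H),
    ∑ j, f.outflow e j (θ + G.τ e) =
      if 0 < G.queue f e θ then G.ν e else min (∑ j, f.inflow e j θ) (G.ν e)
  /-- each player's share of the outflow is her share of the inflow at the entrance time; `φ` is
  the latest entrance time with exit time `θ` -/
  share : ∀ e, ∀ᵐ θ ∂volume.restrict (Set.Ico 0 (G.H + G.τ e)),
    ∃ φ, IsGreatest {x | x < G.H ∧ G.exitTime f e x = θ} φ ∧ ∀ j,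
      f.outflow e j θ =
        if 0 < ∑ i, inflowExt f e i φ then
          inflowExt f e j φ / (∑ i, inflowExt f e i φ) * ∑ i, f.outflow e i θ
        else 0

/-- The information available to the players: the current time and the exit times of all edges. -/
def infoSet : Set (ℝ × (E → ℝ)) := {I | I.1 ∈ Set.Ico 0 G.H ∧ ∀ e, 0 ≤ I.2 e}

/-- The information observed at time `θ` under the flow `f`. -/
def info [Fintype P] (f : Rates E P) (θ : ℝ) : ℝ × (E → ℝ) :=
  (θ, fun e => G.exitTime f e θ)

/-- Strategies of player `j`; only the values on the information set are relevant. -/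
structure IsStrategy [Fintype E] [DecidableEq V] (j : P) (g : E → ℝ × (E → ℝ) → ℝ) : Prop where
  mem_Icc : ∀ e, ∀ I ∈ G.infoSet, g e I ∈ Set.Icc 0 1
  measurable : ∀ e, AEMeasurable (g e) (volume.restrict G.infoSet)
  sum_eq_one : ∀ I ∈ G.infoSet, ∀ v, v ≠ G.t j → ∑ e ∈ G.outEdges v, g e I = 1

/-- Local Lipschitz continuity from the right: every information `I` is the lower corner of a cube
on which `h` is Lipschitz continuous. -/
def RightLipschitz [Fintype E] (h : ℝ × (E → ℝ) → ℝ) : Prop :=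
  ∀ I ∈ G.infoSet, ∃ L > 0, ∃ ε > 0,
    ∀ x ∈ Set.Icc (0 : ℝ × (E → ℝ)) (ε, fun _ => ε),
    ∀ y ∈ Set.Icc (0 : ℝ × (E → ℝ)) (ε, fun _ => ε),
      I + x ∈ G.infoSet → I + y ∈ G.infoSet → |h (I + x) - h (I + y)| ≤ L * ‖x - y‖

/-- The system of equations that turns a strategy profile into inflow rates. -/
structure Follows [Fintype E] [Fintype P] [DecidableEq V]
    (g : P → E → ℝ × (E → ℝ) → ℝ) (f : Rates E P) : Prop where
  source : ∀ j e, G.tail e = G.s j → ∀ᵐ θ ∂volume.restrict (Set.Ico 0 G.H),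
    f.inflow e j θ =
      g j e (G.info f θ) * (∑ e' ∈ G.inEdges (G.s j), f.outflow e' j θ + G.d j)
  inner : ∀ j e, G.tail e ≠ G.s j → G.tail e ≠ G.t j →
    ∀ᵐ θ ∂volume.restrict (Set.Ico 0 G.H),
      f.inflow e j θ = g j e (G.info f θ) * ∑ e' ∈ G.inEdges (G.tail e), f.outflow e' j θ
  sink : ∀ j e, G.tail e = G.t j → ∀ᵐ θ ∂volume.restrict (Set.Ico 0 G.H),
    f.inflow e j θ = 0

end Game

end FlowOverTime

end

noncomputable section

namespace FlowOverTime

/-! On a single edge the inflow determines everything else. Let `Y` be the cumulative inflow minus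
`ν θ`. Operation at capacity forces the queue to be `Y` minus its running minimum
(`queueLength_unique`). Hence the exit time is nondecreasing and Lipschitz in `θ`, it pushes the
inflow measure forward to the outflow measure (`map_arrival`), and fluid merging splits the outflow
among the players. So the only unknowns are the inflow rates `u`, and the problem becomes the
equation `u = response g u` almost everywhere.

This equation is causal with a delay: outflow until `c + τ` depends only on inflow until `c`
(`playerOutflow_ae_congr`). Given `u` until `c`, the flow arriving at every node is therefore known
on a further interval of length at most the minimal transit time. There the exit times enter only as
arguments of the strategies. Exit times do not decrease, so for a short while the information stays
in the cube with lower corner `(c, T c)`; this is why Lipschitz continuity from the right is enough.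
On that cube, exit times determine rates in a Lipschitz way. Rates determine exit times with a
constant proportional to the interval length. On a short interval the composition is a contraction,
so Banach's theorem continues the solution (`exists_extension`), and the same estimate gives local
uniqueness (`FollowsUntil.agree`).

The step length has no uniform lower bound, so the passage to `[0, H)` is a supremum argument
(`continuation`). Solutions on all `[0, c)` with `c < a` are glued to one on `[0, a)` by means of
uniqueness; the bound `rateBound`, capacities plus supplies, excludes blow-up. Finally, `flowOf`
turns `u` into a feasible flow, and conversely every feasible flow following the profile arises in
this way up to null sets. -/

/-- Measurable inflow rates with values in `[0, M]` that vanish outside of `[0, H)`. -/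
structure IsRate (H M : ℝ) (u : ℝ → ℝ) : Prop where
  measurable : Measurable u
  nonneg : ∀ x, 0 ≤ u x
  le : ∀ x, u x ≤ M
  eq_zero : ∀ x, x ∉ Set.Ico 0 H → u x = 0

/-- Cumulative inflow minus the amount that could have been processed at capacity `ν`. -/
def netInflow (ν : ℝ) (U : ℝ → ℝ) (θ : ℝ) : ℝ := cumulative U θ - ν * max θ 0

/-- Running minimum of the net inflow. -/
def runMin (ν : ℝ) (U : ℝ → ℝ) (θ : ℝ) : ℝ := sInf (netInflow ν U '' Set.Iic θ)

/-- Length of the queue in front of a bottleneck of capacity `ν` with inflow rate `U`. -/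
def queueLength (ν : ℝ) (U : ℝ → ℝ) (θ : ℝ) : ℝ := netInflow ν U θ - runMin ν U θ

/-- Exit time of a particle entering at time `θ` an edge with transit time `τ`. -/
def arrival (τ ν : ℝ) (U : ℝ → ℝ) (θ : ℝ) : ℝ := θ + queueLength ν U θ / ν + τ

/-- Total outflow rate of an edge with total inflow rate `U`. -/
def throughput (τ ν : ℝ) (U : ℝ → ℝ) (y : ℝ) : ℝ :=
  if 0 < queueLength ν U (y - τ) then ν else min (U (y - τ)) ν

/-- The latest entrance time with exit time `y`. -/
def entry (τ ν : ℝ) (U : ℝ → ℝ) (y : ℝ) : ℝ := sSup {x | arrival τ ν U x = y}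

/-! ### Bounded rates and their cumulative flow. -/

namespace IsRate

variable {H M ν τ : ℝ} {U U' : ℝ → ℝ}

lemma integrable (hU : IsRate H M U) : Integrable U := by
  have h : U = Set.indicator (Set.Ico 0 H) U := by
    ext x
    by_cases hx : x ∈ Set.Ico 0 H
    · rw [Set.indicator_of_mem hx]
    · rw [Set.indicator_of_notMem hx, hU.eq_zero x hx]
  rw [h, integrable_indicator_iff measurableSet_Ico]
  refine Measure.integrableOn_of_bounded (M := M) (by simp) hU.measurable.aestronglyMeasurable ?_
  filter_upwards with x
  rw [Real.norm_of_nonneg (hU.nonneg x)]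
  exact hU.le x

lemma bound_nonneg (hU : IsRate H M U) : 0 ≤ M := (hU.nonneg 0).trans (hU.le 0)

lemma sum {P : Type*} [Fintype P] {u : P → ℝ → ℝ} (hu : ∀ j, IsRate H M (u j)) :
    IsRate H (Fintype.card P * M) (fun x => ∑ j, u j x) where
  measurable := Finset.measurable_fun_sum _ fun j _ => (hu j).measurable
  nonneg x := Finset.sum_nonneg fun j _ => (hu j).nonneg x
  le x := by
    have := Finset.sum_le_card_nsmul Finset.univ (fun j => u j x) M fun j _ => (hu j).le x
    simpa using this
  eq_zero x hx := Finset.sum_eq_zero fun j _ => (hu j).eq_zero x hx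

lemma cumulative_eq (hU : IsRate H M U) (θ : ℝ) : cumulative U θ = ∫ x in Set.Iic θ, U x := by
  have h : ∫ x in Set.Iic θ, U x = ∫ x in Set.Iic θ, Set.indicator (Set.Ici 0) U x := by
    congr 1
    ext x
    by_cases hx : 0 ≤ x
    · rw [Set.indicator_of_mem (Set.mem_Ici.2 hx)]
    · rw [Set.indicator_of_notMem (by simpa using hx), hU.eq_zero x (by simp [hx])]
  rw [h, setIntegral_indicator measurableSet_Ici, cumulative, ← integral_Icc_eq_integral_Ioc]
  congr 2
  ext x; simp [and_comm]

lemma cumulative_sub (hU : IsRate H M U) {a b : ℝ} (hab : a ≤ b) :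
    cumulative U b - cumulative U a = ∫ x in Set.Ioc a b, U x := by
  rw [hU.cumulative_eq, hU.cumulative_eq,
    intervalIntegral.integral_Iic_sub_Iic hU.integrable.integrableOn hU.integrable.integrableOn,
    intervalIntegral.integral_of_le hab]

lemma cumulative_mono (hU : IsRate H M U) : Monotone (cumulative U) := fun a b hab => by
  have := hU.cumulative_sub hab
  have h2 : 0 ≤ ∫ x in Set.Ioc a b, U x := integral_nonneg hU.nonneg
  linarith

lemma cumulative_sub_le (hU : IsRate H M U) {a b : ℝ} (hab : a ≤ b) :
    cumulative U b - cumulative U a ≤ M * (b - a) := by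
  rw [hU.cumulative_sub hab]
  have := setIntegral_mono (s := Set.Ioc a b) (μ := volume) (f := U) (g := fun _ => M)
    hU.integrable.integrableOn (by simp) hU.le
  simpa [hab, mul_comm] using this

lemma cumulative_of_nonpos (U : ℝ → ℝ) {θ : ℝ} (h : θ ≤ 0) : cumulative U θ = 0 := by
  simp [cumulative, Set.Ioc_eq_empty_of_le h]

lemma lipschitz_cumulative (hU : IsRate H M U) :
    LipschitzWith (Real.toNNReal M) (cumulative U) :=
  LipschitzWith.of_le_add_mul _ fun a b => by
    rw [Real.coe_toNNReal _ hU.bound_nonneg, Real.dist_eq]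
    rcases le_total a b with hab | hab
    · have := hU.cumulative_mono hab
      have := mul_nonneg hU.bound_nonneg (abs_nonneg (a - b))
      linarith
    · have := hU.cumulative_sub_le hab
      rw [abs_of_nonneg (by linarith)]
      linarith

end IsRate

/-! ### Queue, exit time and total outflow of one edge. -/

section Queue

variable {H M ν τ : ℝ} {U U' : ℝ → ℝ}

lemma netInflow_of_nonpos (ν : ℝ) (U : ℝ → ℝ) {θ : ℝ} (h : θ ≤ 0) : netInflow ν U θ = 0 := by
  simp [netInflow, IsRate.cumulative_of_nonpos U h, h]

lemma netInflow_of_nonneg (ν : ℝ) (U : ℝ → ℝ) {θ : ℝ} (h : 0 ≤ θ) :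
    netInflow ν U θ = cumulative U θ - ν * θ := by
  simp [netInflow, h]

lemma IsRate.continuous_cumulative (hU : IsRate H M U) : Continuous (cumulative U) :=
  hU.lipschitz_cumulative.continuous

lemma IsRate.continuous_netInflow (hU : IsRate H M U) : Continuous (netInflow ν U) := by
  unfold netInflow
  have := hU.continuous_cumulative
  fun_prop

lemma max_sub_max_le {a b : ℝ} (hab : a ≤ b) : max b 0 - max a 0 ≤ b - a := by
  rcases le_total a 0 with h | h <;> rcases le_total b 0 with h' | h' <;> simp [h, h'] <;> linarith

/-- The net inflow decreases at most at rate `ν`. -/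
lemma IsRate.netInflow_sub_ge (hU : IsRate H M U) (hν : 0 < ν) {a b : ℝ} (hab : a ≤ b) :
    - ν * (b - a) ≤ netInflow ν U b - netInflow ν U a := by
  have h1 := hU.cumulative_mono hab
  have h2 := mul_le_mul_of_nonneg_left (max_sub_max_le hab) hν.le
  unfold netInflow
  linarith

lemma netInflow_sub_le (U : ℝ → ℝ) (hν : 0 < ν) {a b : ℝ} (hab : a ≤ b) :
    netInflow ν U b - netInflow ν U a ≤ cumulative U b - cumulative U a := by
  have h2 := mul_le_mul_of_nonneg_left (max_le_max_right 0 hab) hν.le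
  unfold netInflow
  linarith

lemma netInflow_image_Iic (ν : ℝ) (U : ℝ → ℝ) (θ : ℝ) :
    netInflow ν U '' Set.Iic θ = netInflow ν U '' Set.Icc (min θ 0) θ := by
  apply Set.Subset.antisymm
  · rintro _ ⟨x, hx, rfl⟩
    rw [Set.mem_Iic] at hx
    rcases le_total (min θ 0) x with h | h
    · exact ⟨x, ⟨h, hx⟩, rfl⟩
    · refine ⟨min θ 0, ⟨le_rfl, min_le_left _ _⟩, ?_⟩
      rw [netInflow_of_nonpos _ _ (min_le_right _ _),
        netInflow_of_nonpos _ _ (h.trans (min_le_right _ _))]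
  · exact Set.image_mono fun x hx => hx.2

lemma IsRate.isLeast_runMin (hU : IsRate H M U) (ν θ : ℝ) :
    IsLeast (netInflow ν U '' Set.Iic θ) (runMin ν U θ) := by
  rw [runMin, netInflow_image_Iic]
  exact (isCompact_Icc.image hU.continuous_netInflow).isLeast_sInf
    (Set.Nonempty.image _ ⟨θ, min_le_left _ _, le_rfl⟩)

lemma IsRate.runMin_le (hU : IsRate H M U) {s θ : ℝ} (h : s ≤ θ) :
    runMin ν U θ ≤ netInflow ν U s := (hU.isLeast_runMin ν θ).2 ⟨s, h, rfl⟩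

lemma IsRate.exists_runMin_eq (hU : IsRate H M U) (ν θ : ℝ) :
    ∃ s ≤ θ, runMin ν U θ = netInflow ν U s := by
  obtain ⟨s, hs, h⟩ := (hU.isLeast_runMin ν θ).1
  exact ⟨s, hs, h.symm⟩

lemma IsRate.runMin_antitone (hU : IsRate H M U) : Antitone (runMin ν U) := fun a b hab => by
  obtain ⟨s, hs, h⟩ := hU.exists_runMin_eq ν a
  rw [h]
  exact hU.runMin_le (hs.trans hab)

lemma IsRate.queueLength_nonneg (hU : IsRate H M U) (θ : ℝ) : 0 ≤ queueLength ν U θ :=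
  sub_nonneg.2 (hU.runMin_le le_rfl)

lemma IsRate.le_queueLength (hU : IsRate H M U) {s θ : ℝ} (h : s ≤ θ) :
    netInflow ν U θ - netInflow ν U s ≤ queueLength ν U θ := by
  have := hU.runMin_le (ν := ν) h
  unfold queueLength
  linarith

lemma IsRate.exists_queueLength_eq (hU : IsRate H M U) (ν θ : ℝ) :
    ∃ s ≤ θ, queueLength ν U θ = netInflow ν U θ - netInflow ν U s := by
  obtain ⟨s, hs, h⟩ := hU.exists_runMin_eq ν θ
  exact ⟨s, hs, by rw [queueLength, h]⟩

lemma IsRate.queueLength_of_nonpos (hU : IsRate H M U) {θ : ℝ} (hθ : θ ≤ 0) :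
    queueLength ν U θ = 0 := by
  obtain ⟨s, hs, h⟩ := hU.exists_queueLength_eq ν θ
  rw [h, netInflow_of_nonpos _ _ hθ, netInflow_of_nonpos _ _ (hs.trans hθ), sub_zero]

lemma IsRate.queueLength_sub_ge (hU : IsRate H M U) (hν : 0 < ν) {a b : ℝ} (hab : a ≤ b) :
    - ν * (b - a) ≤ queueLength ν U b - queueLength ν U a := by
  have h1 := hU.runMin_antitone (ν := ν) hab
  have h2 := hU.netInflow_sub_ge hν hab
  unfold queueLength
  linarith

/-- Let `s` attain the running minimum at `b`. If `s ≤ a`, then `s` also competes at `a`, and only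
the growth of the net inflow from `a` to `b` remains. Otherwise the queue at `b` consists of inflow
after `s`, hence after `a`. -/
lemma IsRate.queueLength_sub_le (hU : IsRate H M U) (hν : 0 < ν) {a b : ℝ} (hab : a ≤ b) :
    queueLength ν U b - queueLength ν U a ≤ cumulative U b - cumulative U a := by
  obtain ⟨s, hs, h⟩ := hU.exists_queueLength_eq ν b
  rcases le_total s a with hsa | hsa
  · have h1 := hU.le_queueLength (ν := ν) hsa
    have h2 := netInflow_sub_le U hν hab
    linarith
  · have h1 := netInflow_sub_le U hν hs
    have h2 := hU.cumulative_mono hsa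
    have h3 := hU.queueLength_nonneg (ν := ν) a
    linarith

/-- First in, first out: the waiting time shrinks at most as fast as time passes, since the queue is
served at rate at most `ν`. -/
lemma IsRate.arrival_mono (hU : IsRate H M U) (hν : 0 < ν) : Monotone (arrival τ ν U) :=
  fun a b hab => by
    have h1 := hU.queueLength_sub_ge hν hab
    have h2 : -(b - a) ≤ (queueLength ν U b - queueLength ν U a) / ν := by
      rw [le_div_iff₀ hν]; linarith
    rw [sub_div] at h2
    unfold arrival
    linarith

lemma IsRate.arrival_sub_le (hU : IsRate H M U) (hν : 0 < ν) {a b : ℝ} (hab : a ≤ b) :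
    arrival τ ν U b - arrival τ ν U a ≤ (1 + M / ν) * (b - a) := by
  have h1 := (hU.queueLength_sub_le hν hab).trans (hU.cumulative_sub_le hab)
  have h2 : (queueLength ν U b - queueLength ν U a) / ν ≤ M / ν * (b - a) := by
    rw [div_le_iff₀ hν]
    field_simp
    linarith
  rw [sub_div] at h2
  unfold arrival
  linarith

lemma IsRate.lipschitz_arrival (hU : IsRate H M U) (hν : 0 < ν) (τ : ℝ) :
    LipschitzWith (Real.toNNReal (1 + M / ν)) (arrival τ ν U) :=
  LipschitzWith.of_le_add_mul _ fun a b => by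
    have h0 : 0 ≤ 1 + M / ν := by have := hU.bound_nonneg; positivity
    rw [Real.coe_toNNReal _ h0, Real.dist_eq]
    rcases le_total a b with hab | hab
    · have := hU.arrival_mono (τ := τ) hν hab
      have := mul_nonneg h0 (abs_nonneg (a - b))
      linarith
    · have := hU.arrival_sub_le (τ := τ) hν hab
      rw [abs_of_nonneg (by linarith)]
      linarith

lemma IsRate.continuous_arrival (hU : IsRate H M U) (hν : 0 < ν) :
    Continuous (arrival τ ν U) := (hU.lipschitz_arrival hν τ).continuous

lemma queueLength_eq_arrival (hν : 0 < ν) (U : ℝ → ℝ) (τ θ : ℝ) :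
    queueLength ν U θ = ν * (arrival τ ν U θ - θ - τ) := by
  unfold arrival
  field_simp
  ring

lemma IsRate.continuous_queueLength (hU : IsRate H M U) (hν : 0 < ν) :
    Continuous (queueLength ν U) := by
  have : queueLength ν U = fun θ => ν * (arrival 0 ν U θ - θ - 0) :=
    funext fun θ => queueLength_eq_arrival hν U 0 θ
  rw [this]
  have := hU.continuous_arrival (τ := 0) hν
  fun_prop

lemma IsRate.le_arrival (hU : IsRate H M U) (hν : 0 < ν) (θ : ℝ) : θ + τ ≤ arrival τ ν U θ := by
  have := div_nonneg (hU.queueLength_nonneg (ν := ν) θ) hν.le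
  unfold arrival
  linarith

lemma IsRate.arrival_of_nonpos (hU : IsRate H M U) {θ : ℝ} (hθ : θ ≤ 0) :
    arrival τ ν U θ = θ + τ := by
  simp [arrival, hU.queueLength_of_nonpos hθ]

/-- Extending the model by empty queues to negative times makes the exit time unbounded below, so
that it is onto ℝ and `entry` never takes a junk value. -/
lemma IsRate.exists_arrival_eq (hU : IsRate H M U) (hν : 0 < ν) (y : ℝ) :
    ∃ x, arrival τ ν U x = y := by
  have h1 : arrival τ ν U (min 0 (y - τ)) ≤ y := by
    rw [hU.arrival_of_nonpos (min_le_left _ _)]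
    linarith [min_le_right 0 (y - τ)]
  have h2 : y ≤ arrival τ ν U (y - τ) := by linarith [hU.le_arrival (τ := τ) hν (y - τ)]
  obtain ⟨x, -, hx⟩ := intermediate_value_Icc (min_le_right 0 (y - τ))
    (hU.continuous_arrival hν).continuousOn ⟨h1, h2⟩
  exact ⟨x, hx⟩

lemma IsRate.isGreatest_entry (hU : IsRate H M U) (hν : 0 < ν) (y : ℝ) :
    IsGreatest {x | arrival τ ν U x = y} (entry τ ν U y) := by
  have hne : {x | arrival τ ν U x = y}.Nonempty := hU.exists_arrival_eq hν y
  have hb : BddAbove {x | arrival τ ν U x = y} := ⟨y - τ, fun x hx => by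
    have := hU.le_arrival (τ := τ) hν x
    rw [Set.mem_ofPred_eq] at hx
    linarith⟩
  have hc : IsClosed {x | arrival τ ν U x = y} :=
    isClosed_eq (hU.continuous_arrival hν) continuous_const
  exact ⟨hc.csSup_mem hne hb, fun x hx => le_csSup hb hx⟩

lemma IsRate.arrival_entry (hU : IsRate H M U) (hν : 0 < ν) (y : ℝ) :
    arrival τ ν U (entry τ ν U y) = y := (hU.isGreatest_entry hν y).1

lemma IsRate.le_entry (hU : IsRate H M U) (hν : 0 < ν) (x : ℝ) :
    x ≤ entry τ ν U (arrival τ ν U x) := (hU.isGreatest_entry hν _).2 rfl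

lemma IsRate.entry_le (hU : IsRate H M U) (hν : 0 < ν) (y : ℝ) : entry τ ν U y ≤ y - τ := by
  have h1 := hU.le_arrival (τ := τ) hν (entry τ ν U y)
  rw [hU.arrival_entry hν] at h1
  linarith

/-- A Galois connection: preimages of half-lines under the exit time are half-lines, which makes
pushforward measures computable. -/
lemma IsRate.arrival_le_iff (hU : IsRate H M U) (hν : 0 < ν) {x y : ℝ} :
    arrival τ ν U x ≤ y ↔ x ≤ entry τ ν U y := by
  constructor
  · intro h
    by_contra! h'
    have h1 := hU.arrival_mono (τ := τ) hν h'.le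
    rw [hU.arrival_entry hν] at h1
    exact h'.not_ge ((hU.isGreatest_entry hν y).2 (le_antisymm h h1))
  · intro h
    rw [← hU.arrival_entry (τ := τ) hν y]
    exact hU.arrival_mono hν h

lemma IsRate.entry_mono (hU : IsRate H M U) (hν : 0 < ν) : Monotone (entry τ ν U) :=
  fun a b hab => by
    rw [← hU.arrival_le_iff hν, hU.arrival_entry hν]
    exact hab

/-- The total outflow rate of the edge at time `θ + τ`. -/
lemma throughput_add (τ ν : ℝ) (U : ℝ → ℝ) (θ : ℝ) :
    throughput τ ν U (θ + τ) = if 0 < queueLength ν U θ then ν else min (U θ) ν := by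
  simp [throughput]

lemma IsRate.throughput_nonneg (hU : IsRate H M U) (hν : 0 < ν) (y : ℝ) :
    0 ≤ throughput τ ν U y := by
  unfold throughput
  split_ifs
  · exact hν.le
  · exact le_min (hU.nonneg _) hν.le

lemma throughput_le (τ ν : ℝ) (U : ℝ → ℝ) (y : ℝ) : throughput τ ν U y ≤ ν := by
  unfold throughput
  split_ifs
  · exact le_rfl
  · exact min_le_right _ _

lemma IsRate.throughput_of_lt (hU : IsRate H M U) (hν : 0 < ν) {y : ℝ} (hy : y < τ) :
    throughput τ ν U y = 0 := by
  rw [throughput, hU.queueLength_of_nonpos (by linarith), hU.eq_zero _ (by simp; intro; linarith)]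
  simp [hν.le]

lemma IsRate.measurable_throughput (hU : IsRate H M U) (hν : 0 < ν) :
    Measurable (throughput τ ν U) := by
  unfold throughput
  have h1 : Measurable fun y => queueLength ν U (y - τ) :=
    ((hU.continuous_queueLength hν).comp (continuous_id.sub continuous_const)).measurable
  have h2 : Measurable fun y => U (y - τ) := hU.measurable.comp (measurable_id.sub_const τ)
  exact Measurable.ite (measurableSet_lt measurable_const h1) measurable_const
    (h2.min measurable_const)

/-- With a queue present, the net inflow near `θ` stays above the running minimum, so the minimum is
attained earlier and is locally constant. A local maximum is enough to make the derivative vanish.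
-/
lemma IsRate.isLocalMax_runMin (hU : IsRate H M U) {θ : ℝ} (hθ : 0 < queueLength ν U θ) :
    IsLocalMax (runMin ν U) θ := by
  have h1 : ∀ᶠ s in nhds θ, runMin ν U θ < netInflow ν U s :=
    (hU.continuous_netInflow.tendsto θ).eventually_const_lt (sub_pos.1 hθ)
  obtain ⟨ε, hε, h⟩ := Metric.eventually_nhds_iff.1 h1
  refine Metric.eventually_nhds_iff.2 ⟨ε, hε, fun s hs => ?_⟩
  rcases le_total θ s with hle | hle
  · exact hU.runMin_antitone hle
  · obtain ⟨m, hm, hmeq⟩ := hU.exists_runMin_eq ν θ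
    rcases le_total m s with hms | hms
    · rw [hmeq]; exact hU.runMin_le hms
    · have : dist m θ < ε := by
        rw [Real.dist_eq, abs_lt] at hs ⊢
        constructor <;> linarith
      exact absurd hmeq (h this).ne

/-- If the queue is positive, the running minimum has derivative `0`, and the queue changes at rate
`U - ν`. If it is empty, the queue is at its minimum and has derivative `0`; monotonicity of the
running minimum then forces `U ≤ ν`, so all inflow passes directly. -/
lemma IsRate.ae_hasDerivAt_queueLength (hU : IsRate H M U) (hν : 0 < ν) (τ : ℝ) :
    ∀ᵐ θ, 0 < θ → HasDerivAt (queueLength ν U) (U θ - throughput τ ν U (θ + τ)) θ := by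
  have hT := (hU.lipschitz_arrival hν 0).ae_differentiableAt_real
  have hF := LocallyIntegrable.ae_hasDerivAt_integral hU.integrable.locallyIntegrable
  filter_upwards [hT, hF] with θ h1 h2 hpos
  have hz : DifferentiableAt ℝ (queueLength ν U) θ := by
    have : queueLength ν U = fun θ => ν * (arrival 0 ν U θ - θ - 0) :=
      funext fun θ => queueLength_eq_arrival hν U 0 θ
    rw [this]
    exact ((h1.sub differentiableAt_id).sub_const 0).const_mul ν
  have hY : HasDerivAt (netInflow ν U) (U θ - ν) θ := by
    have h3 := (h2 0).sub ((hasDerivAt_id θ).const_mul ν)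
    rw [mul_one] at h3
    refine h3.congr_of_eventuallyEq ?_
    filter_upwards [lt_mem_nhds hpos] with x hx
    simp [netInflow_of_nonneg _ _ hx.le, cumulative, intervalIntegral.integral_of_le hx.le]
  have hQ : HasDerivAt (runMin ν U) (U θ - ν - deriv (queueLength ν U) θ) θ := by
    have h3 := hY.sub hz.hasDerivAt
    have h4 : netInflow ν U - queueLength ν U = runMin ν U := by
      ext x; simp [queueLength]
    rwa [h4] at h3
  rw [throughput_add]
  suffices h : deriv (queueLength ν U) θ =
      U θ - if 0 < queueLength ν U θ then ν else min (U θ) ν by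
    rw [← h]; exact hz.hasDerivAt
  split_ifs with hq
  · have := (hU.isLocalMax_runMin hq).hasDerivAt_eq_zero hQ
    linarith
  · have h0 : queueLength ν U θ = 0 := le_antisymm (not_lt.1 hq) (hU.queueLength_nonneg θ)
    have hmin : IsLocalMin (queueLength ν U) θ := by
      filter_upwards with s
      rw [h0]; exact hU.queueLength_nonneg s
    have h3 := hmin.deriv_eq_zero
    have h4 : deriv (runMin ν U) θ ≤ 0 := hU.runMin_antitone.deriv_nonpos
    rw [hQ.deriv, h3] at h4
    rw [h3, min_eq_left (by linarith), sub_self]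

lemma IsRate.integrableOn_throughput (hU : IsRate H M U) (hν : 0 < ν) (a b : ℝ) :
    IntegrableOn (throughput τ ν U) (Set.Ioc a b) := by
  refine Measure.integrableOn_of_bounded (M := ν) (by simp)
    (hU.measurable_throughput hν).aestronglyMeasurable ?_
  filter_upwards with x
  rw [Real.norm_of_nonneg (hU.throughput_nonneg hν x)]
  exact throughput_le _ _ _ _

/-- Shifting the integration variable by the transit time. -/
lemma cumulative_shift {w : ℝ → ℝ} (hw : ∀ᵐ y ∂volume.restrict (Set.Ico 0 τ), w y = 0)
    (hτ : 0 ≤ τ) {θ : ℝ} (hθ : 0 ≤ θ) (hi : IntegrableOn w (Set.Ioc 0 (θ + τ))) :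
    cumulative w (θ + τ) = ∫ x in (0 : ℝ)..θ, w (x + τ) := by
  rw [intervalIntegral.integral_comp_add_right, cumulative,
    ← intervalIntegral.integral_of_le (by linarith),
    ← intervalIntegral.integral_add_adjacent_intervals (b := τ), zero_add]
  · rw [intervalIntegral.integral_of_le hτ, ← integral_Icc_eq_integral_Ioc,
      integral_Icc_eq_integral_Ico, integral_eq_zero_of_ae hw, zero_add]
  · rw [intervalIntegrable_iff_integrableOn_Ioc_of_le hτ]
    exact hi.mono_set (Set.Ioc_subset_Ioc_right (by linarith))
  · rw [intervalIntegrable_iff_integrableOn_Ioc_of_le (by linarith)]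
    exact hi.mono_set (Set.Ioc_subset_Ioc_left hτ)

lemma IsRate.throughput_ae_zero (hU : IsRate H M U) (hν : 0 < ν) :
    ∀ᵐ y ∂volume.restrict (Set.Ico 0 τ), throughput τ ν U y = 0 := by
  filter_upwards [ae_restrict_mem measurableSet_Ico] with y hy
  exact hU.throughput_of_lt hν hy.2

/-- The queue length is Lipschitz, hence absolutely continuous, and is recovered by integrating its
almost everywhere derivative. -/
lemma IsRate.cumulative_throughput (hU : IsRate H M U) (hν : 0 < ν) (hτ : 0 ≤ τ) (θ : ℝ) :
    cumulative (throughput τ ν U) (θ + τ) = cumulative U θ - queueLength ν U θ := by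
  rcases le_total θ 0 with hθ | hθ
  · rw [cumulative_of_nonpos _ hθ, hU.queueLength_of_nonpos hθ, sub_zero, cumulative,
      ← integral_Icc_eq_integral_Ioc, integral_Icc_eq_integral_Ico]
    refine integral_eq_zero_of_ae ?_
    filter_upwards [ae_restrict_mem measurableSet_Ico] with y hy
    exact hU.throughput_of_lt hν (by linarith [hy.2])
  have hac : AbsolutelyContinuousOnInterval (queueLength ν U) 0 θ := by
    have : queueLength ν U = fun θ => ν * (arrival 0 ν U θ - θ) := by
      ext θ; rw [queueLength_eq_arrival hν U 0 θ, sub_zero]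
    rw [this]
    exact (((hU.lipschitz_arrival hν 0).lipschitzOnWith).absolutelyContinuousOnInterval.sub
      (LipschitzWith.id.lipschitzOnWith).absolutelyContinuousOnInterval).const_mul ν
  have h1 := hac.integral_deriv_eq_sub
  have hd := hU.ae_hasDerivAt_queueLength hν τ
  have hw : IntervalIntegrable (fun x => throughput τ ν U (x + τ)) volume 0 θ := by
    have : IntervalIntegrable (throughput τ ν U) volume (0 + τ) (θ + τ) := by
      rw [intervalIntegrable_iff_integrableOn_Ioc_of_le (by linarith)]
      exact hU.integrableOn_throughput hν _ _
    simpa using this.comp_add_right τ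
  have h2 : ∫ x in (0 : ℝ)..θ, deriv (queueLength ν U) x =
      ∫ x in (0 : ℝ)..θ, (U x - throughput τ ν U (x + τ)) := by
    apply intervalIntegral.integral_congr_ae
    filter_upwards [hd] with x hx hx'
    rw [Set.uIoc_of_le hθ] at hx'
    exact (hx hx'.1).deriv
  rw [h2, intervalIntegral.integral_sub hU.integrable.intervalIntegrable hw,
    hU.queueLength_of_nonpos le_rfl, sub_zero,
    ← cumulative_shift (hU.throughput_ae_zero hν) hτ hθ (hU.integrableOn_throughput hν _ _),
    intervalIntegral.integral_of_le hθ, ← cumulative] at h1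
  linarith

/-- Flow that has entered by time `θ` has left by the exit time of the particles entering then. -/
lemma IsRate.cumulative_throughput_arrival (hU : IsRate H M U) (hν : 0 < ν) (hτ : 0 ≤ τ) (θ : ℝ) :
    cumulative (throughput τ ν U) (arrival τ ν U θ) = cumulative U θ := by
  rw [arrival, hU.cumulative_throughput hν hτ]
  have hz := hU.queueLength_nonneg (ν := ν) θ
  set θ' := θ + queueLength ν U θ / ν with hθ'
  have hle : θ ≤ θ' := by rw [hθ']; have := div_nonneg hz hν.le; linarith
  -- `θ'` is the time at which the queue present at `θ` has been served. Even without further inflow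
  -- the net inflow needs until `θ'` to fall to the old minimum. Hence the outflow by `θ' + τ`,
  -- which is `ν θ' + runMin ν U θ'`, equals the inflow by `θ`.
  have hQ : runMin ν U θ' = runMin ν U θ := by
    refine le_antisymm (hU.runMin_antitone hle) ?_
    obtain ⟨s, hs, h⟩ := hU.exists_runMin_eq ν θ'
    rw [h]
    rcases le_total s θ with hsθ | hsθ
    · exact hU.runMin_le hsθ
    · have h1 := hU.netInflow_sub_ge hν hsθ
      have h2 : ν * (s - θ) ≤ queueLength ν U θ := by
        have : s - θ ≤ queueLength ν U θ / ν := by linarith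
        rw [le_div_iff₀ hν] at this
        linarith
      unfold queueLength at h2
      linarith
  rcases le_total θ 0 with h0 | h0
  · have : θ' = θ := by rw [hθ', hU.queueLength_of_nonpos h0]; simp
    rw [this, hU.queueLength_of_nonpos h0, sub_zero]
  · have h3 : ν * (θ' - θ) = queueLength ν U θ := by rw [hθ']; field_simp; ring
    rw [queueLength, netInflow_of_nonneg _ _ (h0.trans hle), hQ]
    rw [queueLength, netInflow_of_nonneg _ _ h0] at h3
    linarith

/-- The queue length is determined by the inflow, since edges operate at capacity. -/
lemma IsRate.queueLength_unique (hU : IsRate H M U) {z w : ℝ → ℝ} {b : ℝ}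
    (hw : IntegrableOn w (Set.Ico 0 b))
    (hz : ∀ θ ∈ Set.Ico 0 b, z θ = cumulative U θ - ∫ x in (0 : ℝ)..θ, w x)
    (hz0 : ∀ θ ∈ Set.Ico 0 b, 0 ≤ z θ) (hwν : ∀ᵐ x ∂volume.restrict (Set.Ico 0 b), w x ≤ ν)
    (hpos : ∀ᵐ x ∂volume.restrict (Set.Ico 0 b), 0 < z x → w x = ν) {θ : ℝ}
    (hθ : θ ∈ Set.Ico 0 b) : z θ = queueLength ν U θ := by
  have hint : ∀ {x y : ℝ}, 0 ≤ x → x ≤ y → y < b → IntervalIntegrable w volume x y := by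
    intro x y hx hxy hy
    rw [intervalIntegrable_iff_integrableOn_Ioc_of_le hxy]
    exact hw.mono_set fun r hr => ⟨hx.trans hr.1.le, hr.2.trans_lt hy⟩
  have hdiff : ∀ {x y : ℝ}, 0 ≤ x → x ≤ y → y < b →
      z y - z x = cumulative U y - cumulative U x - ∫ r in x..y, w r := by
    intro x y hx hxy hy
    rw [hz y ⟨hx.trans hxy, hy⟩, hz x ⟨hx, hxy.trans_lt hy⟩,
      ← intervalIntegral.integral_add_adjacent_intervals (hint le_rfl hx (hxy.trans_lt hy))
        (hint hx hxy hy)]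
    ring
  have hcont : ContinuousOn z (Set.Icc 0 θ) := by
    have h1 : ContinuousOn (fun y => cumulative U y - ∫ r in (0 : ℝ)..y, w r) (Set.Icc 0 θ) := by
      refine hU.continuous_cumulative.continuousOn.sub ?_
      have := intervalIntegral.continuousOn_primitive_interval' (b₁ := 0) (b₂ := θ) (a := 0)
        (hint le_rfl hθ.1 hθ.2) (by simp)
      rwa [Set.uIcc_of_le hθ.1] at this
    exact h1.congr fun y hy => hz y ⟨hy.1, hy.2.trans_lt hθ.2⟩
  apply le_antisymm
  · have hzero : z 0 = 0 := by
      rw [hz 0 ⟨le_rfl, hθ.1.trans_lt hθ.2⟩, IsRate.cumulative_of_nonpos _ le_rfl]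
      simp
    -- Upper bound: after the last zero `s` of `z` the edge works at capacity, so `z θ` is exactly
    -- the net inflow gained since `s`.
    set S := {s | s ∈ Set.Icc 0 θ ∧ z s = 0} with hS
    have hSc : IsCompact S := by
      have : S = Set.Icc 0 θ ∩ z ⁻¹' {0} := by ext; simp [hS]
      rw [this]
      exact isCompact_Icc.of_isClosed_subset
        (hcont.preimage_isClosed_of_isClosed isClosed_Icc isClosed_singleton) Set.inter_subset_left
    obtain ⟨⟨hs, hs0⟩, hmax⟩ := hSc.isGreatest_sSup ⟨0, ⟨le_rfl, hθ.1⟩, hzero⟩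
    set s := sSup S
    have hint' : ∫ r in s..θ, w r = ν * (θ - s) := by
      have : ∫ r in s..θ, w r = ∫ r in s..θ, ν := by
        apply intervalIntegral.integral_congr_ae
        have := (ae_restrict_iff' measurableSet_Ico).1 hpos
        filter_upwards [this] with r hr hrmem
        rw [Set.uIoc_of_le hs.2] at hrmem
        have h0 : 0 ≤ r := hs.1.trans hrmem.1.le
        have hlt : r < b := hrmem.2.trans_lt hθ.2
        refine hr ⟨h0, hlt⟩ (lt_of_le_of_ne (hz0 r ⟨h0, hlt⟩) fun h => ?_)
        exact hrmem.1.not_ge (hmax ⟨⟨h0, hrmem.2⟩, h.symm⟩)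
      rw [this]; simp; ring
    have h1 := hdiff hs.1 hs.2 hθ.2
    have h2 := hU.le_queueLength (ν := ν) hs.2
    rw [netInflow_of_nonneg _ _ hs.1, netInflow_of_nonneg _ _ hθ.1] at h2
    linarith
  -- Lower bound: outflow at most `ν` and `z s ≥ 0` bound `z θ` from below by every increment of the
  -- net inflow, and the queue length is the largest of them.
  · have key : ∀ s, 0 ≤ s → s ≤ θ → netInflow ν U θ - netInflow ν U s ≤ z θ := by
      intro s hs hsθ
      have h1 := hdiff hs hsθ hθ.2
      have h2 := hz0 s ⟨hs, hsθ.trans_lt hθ.2⟩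
      have h3 : ∫ r in s..θ, w r ≤ ∫ r in s..θ, ν := by
        apply intervalIntegral.integral_mono_ae_restrict hsθ (hint hs hsθ hθ.2) (by simp)
        have := (ae_restrict_iff' measurableSet_Ico).1 hwν
        rw [Filter.EventuallyLE, ae_restrict_iff' measurableSet_Icc]
        filter_upwards [this] with r hr hrmem
        exact hr ⟨hs.trans hrmem.1, hrmem.2.trans_lt hθ.2⟩
      simp only [intervalIntegral.integral_const, smul_eq_mul] at h3
      rw [netInflow_of_nonneg _ _ hs, netInflow_of_nonneg _ _ hθ.1]
      linarith
    obtain ⟨s, hs, h⟩ := hU.exists_queueLength_eq ν θ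
    rw [h]
    rcases le_total s 0 with h0 | h0
    · have := key 0 le_rfl hθ.1
      rw [netInflow_of_nonpos _ _ h0]
      rwa [netInflow_of_nonpos _ _ le_rfl] at this
    · exact key s h0 hs

/-- The exit time is Lipschitz continuous in the cumulative inflow. -/
lemma IsRate.abs_arrival_sub_le {M' : ℝ} (hU : IsRate H M U) (hU' : IsRate H M' U') (hν : 0 < ν)
    {θ D : ℝ} (h : ∀ s ≤ θ, |cumulative U s - cumulative U' s| ≤ D) :
    |arrival τ ν U θ - arrival τ ν U' θ| ≤ 2 / ν * D := by
  have key : ∀ {M₁ M₂ : ℝ} {U₁ U₂ : ℝ → ℝ}, IsRate H M₁ U₁ → IsRate H M₂ U₂ →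
      (∀ s ≤ θ, |cumulative U₁ s - cumulative U₂ s| ≤ D) →
      queueLength ν U₁ θ - queueLength ν U₂ θ ≤ 2 * D := by
    intro M₁ M₂ U₁ U₂ h₁ h₂ h
    -- The factor `2` arises because a queue is a difference of net inflows at the two times `θ` and
    -- `s`, each perturbed by at most `D`.
    obtain ⟨s, hs, hq⟩ := h₁.exists_queueLength_eq ν θ
    have h1 := h₂.le_queueLength (ν := ν) hs
    have h2 := abs_le.1 (h s hs)
    have h3 := abs_le.1 (h θ le_rfl)
    unfold netInflow at *
    linarith
  have h1 := key hU hU' h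
  have h2 := key hU' hU fun s hs => by rw [abs_sub_comm]; exact h s hs
  have h3 : arrival τ ν U θ - arrival τ ν U' θ =
      (queueLength ν U θ - queueLength ν U' θ) / ν := by unfold arrival; ring
  rw [h3, abs_div, abs_of_pos hν, div_mul_eq_mul_div, div_le_div_iff_of_pos_right hν, abs_le]
  constructor <;> linarith

lemma IsRate.cumulative_congr {c θ : ℝ} (h : ∀ᵐ x ∂volume.restrict (Set.Ico 0 c), U x = U' x)
    (hθ : θ ≤ c) : cumulative U θ = cumulative U' θ := by
  unfold cumulative
  rw [← integral_Icc_eq_integral_Ioc, integral_Icc_eq_integral_Ico, ← integral_Icc_eq_integral_Ioc,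
    integral_Icc_eq_integral_Ico]
  exact integral_congr_ae (ae_restrict_of_ae_restrict_of_subset (Set.Ico_subset_Ico_right hθ) h)

lemma queueLength_congr {c θ : ℝ} (h : ∀ᵐ x ∂volume.restrict (Set.Ico 0 c), U x = U' x)
    (hθ : θ ≤ c) : queueLength ν U θ = queueLength ν U' θ := by
  have h1 : ∀ s ≤ c, netInflow ν U s = netInflow ν U' s := fun s hs => by
    rw [netInflow, netInflow, IsRate.cumulative_congr h hs]
  rw [queueLength, queueLength, runMin, runMin, h1 θ hθ,
    Set.image_congr fun s (hs : s ∈ Set.Iic θ) => h1 s (le_trans hs hθ)]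

lemma arrival_congr {c θ : ℝ} (h : ∀ᵐ x ∂volume.restrict (Set.Ico 0 c), U x = U' x)
    (hθ : θ ≤ c) : arrival τ ν U θ = arrival τ ν U' θ := by
  rw [arrival, arrival, queueLength_congr h hθ]

/-- Exit time maps send null sets to null sets. -/
lemma IsRate.arrival_image_null (hU : IsRate H M U) (hν : 0 < ν) {N : Set ℝ}
    (hN : volume N = 0) : volume (arrival τ ν U '' N) = 0 := by
  have := (hU.lipschitz_arrival hν τ).hausdorffMeasure_image_le zero_le_one N
  rw [hausdorffMeasure_real, hN, mul_zero] at this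
  exact nonpos_iff_eq_zero.1 this

end Queue

/-! ### Splitting the outflow among the players. -/

section Merging

variable {P : Type*} [Fintype P] {H M ν τ : ℝ} {U U' : ℝ → ℝ} {u u' : P → ℝ → ℝ}

/-- Total inflow rate of all players. -/
def totalRate (u : P → ℝ → ℝ) (x : ℝ) : ℝ := ∑ j, u j x

/-- Outflow rates of the players on an edge with inflow rates `u`. -/
def playerOutflow (τ ν : ℝ) (u : P → ℝ → ℝ) (j : P) (y : ℝ) : ℝ :=
  u j (entry τ ν (totalRate u) y) / totalRate u (entry τ ν (totalRate u) y) *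
    throughput τ ν (totalRate u) y

lemma IsRate.totalRate (hu : ∀ j, IsRate H M (u j)) :
    IsRate H (Fintype.card P * M) (totalRate u) := IsRate.sum hu

lemma le_totalRate (hu : ∀ j, IsRate H M (u j)) (j : P) (x : ℝ) : u j x ≤ totalRate u x :=
  Finset.single_le_sum (f := fun j => u j x) (fun i _ => (hu i).nonneg x) (Finset.mem_univ j)

lemma playerOutflow_nonneg (hu : ∀ j, IsRate H M (u j)) (hν : 0 < ν) (j : P) (y : ℝ) :
    0 ≤ playerOutflow τ ν u j y :=
  mul_nonneg (div_nonneg ((hu j).nonneg _) ((IsRate.totalRate hu).nonneg _))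
    ((IsRate.totalRate hu).throughput_nonneg hν y)

lemma playerOutflow_le (hu : ∀ j, IsRate H M (u j)) (hν : 0 < ν) (j : P) (y : ℝ) :
    playerOutflow τ ν u j y ≤ ν := by
  refine le_trans ?_ (throughput_le τ ν (totalRate u) y)
  exact mul_le_of_le_one_left ((IsRate.totalRate hu).throughput_nonneg hν y)
    (div_le_one_of_le₀ (le_totalRate hu j _) ((IsRate.totalRate hu).nonneg _))

lemma playerOutflow_of_lt (hu : ∀ j, IsRate H M (u j)) (hν : 0 < ν) (j : P) {y : ℝ} (hy : y < τ) :
    playerOutflow τ ν u j y = 0 := by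
  rw [playerOutflow, (IsRate.totalRate hu).throughput_of_lt hν hy, mul_zero]

lemma measurable_playerOutflow (hu : ∀ j, IsRate H M (u j)) (hν : 0 < ν) (j : P) :
    Measurable (playerOutflow τ ν u j) := by
  have hU := IsRate.totalRate hu
  have hφ := (hU.entry_mono (τ := τ) hν).measurable
  exact (((hu j).measurable.comp hφ).div (hU.measurable.comp hφ)).mul
    (hU.measurable_throughput hν)

lemma setLIntegral_Iic_eq_cumulative {w : ℝ → ℝ} {y : ℝ} (h0 : ∀ x, 0 ≤ w x)
    (hneg : ∀ x < 0, w x = 0) (hi : IntegrableOn w (Set.Ioc 0 y)) :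
    ∫⁻ x in Set.Iic y, ENNReal.ofReal (w x) = ENNReal.ofReal (cumulative w y) := by
  have h : (fun x => ENNReal.ofReal (w x)) =
      (Set.Ici 0).indicator fun x => ENNReal.ofReal (w x) := by
    ext x
    by_cases hx : 0 ≤ x
    · rw [Set.indicator_of_mem (Set.mem_Ici.2 hx)]
    · rw [Set.indicator_of_notMem (by simpa using hx), hneg x (not_le.1 hx), ENNReal.ofReal_zero]
  have h2 : Set.Ici 0 ∩ Set.Iic y = Set.Icc 0 y := by ext; simp
  rw [h, setLIntegral_indicator measurableSet_Ici, h2, cumulative,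
    ofReal_integral_eq_lintegral_ofReal hi (Filter.Eventually.of_forall h0),
    restrict_Ioc_eq_restrict_Icc]

/-- The measure with density `U`. -/
def rateMeasure (U : ℝ → ℝ) : Measure ℝ := volume.withDensity fun x => ENNReal.ofReal (U x)

lemma IsRate.rateMeasure_Iic (hU : IsRate H M U) (y : ℝ) :
    rateMeasure U (Set.Iic y) = ENNReal.ofReal (cumulative U y) := by
  rw [rateMeasure, withDensity_apply _ measurableSet_Iic,
    setLIntegral_Iic_eq_cumulative hU.nonneg (fun x hx => hU.eq_zero x (by simp; intro; linarith))
      hU.integrable.integrableOn]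

/-- The exit time map transports the inflow to the outflow. -/
lemma IsRate.map_arrival (hU : IsRate H M U) (hν : 0 < ν) (hτ : 0 ≤ τ) :
    (rateMeasure U).map (arrival τ ν U) = rateMeasure (throughput τ ν U) := by
  have hfin : IsFiniteMeasure (rateMeasure U) :=
    isFiniteMeasure_withDensity_ofReal hU.integrable.2
  -- Both half-line masses are the inflow until `entry y`, because that flow has left by its exit
  -- time `y`.
  refine Measure.ext_of_Iic _ _ fun y => ?_
  have hpre : arrival τ ν U ⁻¹' Set.Iic y = Set.Iic (entry τ ν U y) := by
    ext x; exact hU.arrival_le_iff hν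
  rw [Measure.map_apply (hU.continuous_arrival hν).measurable measurableSet_Iic, hpre,
    hU.rateMeasure_Iic, rateMeasure, withDensity_apply _ measurableSet_Iic,
    setLIntegral_Iic_eq_cumulative (hU.throughput_nonneg hν)
      (fun x hx => hU.throughput_of_lt hν (by linarith)) (hU.integrableOn_throughput hν _ _)]
  conv_rhs => rw [← hU.arrival_entry (τ := τ) hν y]
  rw [hU.cumulative_throughput_arrival hν hτ]

/-- The exit time is constant between `x` and its latest companion. If these differ, a rational lies
between them, so the exit time is one of countably many values. Those carry no outflow, since the
outflow has a density, and hence their preimages carry no inflow. -/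
lemma IsRate.ae_entry_arrival (hU : IsRate H M U) (hν : 0 < ν) (hτ : 0 ≤ τ) :
    ∀ᵐ x ∂rateMeasure U, entry τ ν U (arrival τ ν U x) = x := by
  have hT := (hU.continuous_arrival (τ := τ) hν).measurable
  have hnull : ∀ q : ℚ, ∀ᵐ x ∂rateMeasure U, arrival τ ν U x ≠ arrival τ ν U q := by
    intro q
    have h1 : ∀ᵐ y ∂(rateMeasure U).map (arrival τ ν U), y ≠ arrival τ ν U q := by
      rw [hU.map_arrival hν hτ]
      exact (withDensity_absolutelyContinuous volume _).ae_le (Measure.ae_ne volume _)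
    exact ae_of_ae_map hT.aemeasurable h1
  filter_upwards [ae_all_iff.2 hnull] with x hx
  refine le_antisymm ?_ (hU.le_entry hν x)
  by_contra! hlt
  obtain ⟨q, hq1, hq2⟩ := exists_rat_btwn hlt
  refine hx q (le_antisymm (hU.arrival_mono hν hq1.le) ?_)
  have := hU.arrival_mono (τ := τ) hν hq2.le
  rwa [hU.arrival_entry hν] at this

/-- Positivity holds almost everywhere for the inflow measure and is transported by the exit time.
It ensures that the players' shares add up to `1` wherever there is outflow. -/
lemma IsRate.ae_totalRate_pos (hU : IsRate H M U) (hν : 0 < ν) (hτ : 0 ≤ τ) :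
    ∀ᵐ y, throughput τ ν U y ≠ 0 → 0 < U (entry τ ν U y) := by
  have hT := (hU.continuous_arrival (τ := τ) hν).measurable
  have hφ := (hU.entry_mono (τ := τ) hν).measurable
  have hms : MeasurableSet {y | 0 < U (entry τ ν U y)} :=
    measurableSet_lt measurable_const (hU.measurable.comp hφ)
  have h1 : ∀ᵐ y ∂(rateMeasure U).map (arrival τ ν U), 0 < U (entry τ ν U y) := by
    rw [ae_map_iff hT.aemeasurable hms]
    have h2 : ∀ᵐ x ∂rateMeasure U, 0 < U x := by
      rw [rateMeasure, ae_withDensity_iff hU.measurable.ennreal_ofReal]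
      filter_upwards with x hx
      simpa using hx
    filter_upwards [hU.ae_entry_arrival hν hτ, h2] with x hx hx2
    rwa [hx]
  rw [hU.map_arrival hν hτ, rateMeasure,
    ae_withDensity_iff (hU.measurable_throughput hν).ennreal_ofReal] at h1
  filter_upwards [h1] with y hy hne
  refine hy ?_
  have := lt_of_le_of_ne (hU.throughput_nonneg hν y) hne.symm
  simpa using this

/-- The outflow rates of the players add up to the total outflow rate. -/
lemma ae_sum_playerOutflow (hu : ∀ j, IsRate H M (u j)) (hν : 0 < ν) (hτ : 0 ≤ τ) :
    ∀ᵐ y, ∑ j, playerOutflow τ ν u j y = throughput τ ν (totalRate u) y := by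
  have hU := IsRate.totalRate hu
  filter_upwards [hU.ae_totalRate_pos hν hτ] with y hy
  unfold playerOutflow
  rw [← Finset.sum_mul, ← Finset.sum_div]
  by_cases h : throughput τ ν (totalRate u) y = 0
  · rw [h, mul_zero]
  · have h1 := (hy h).ne'
    rw [show ∑ j, u j (entry τ ν (totalRate u) y) = totalRate u (entry τ ν (totalRate u) y)
      from rfl, div_self h1, one_mul]

lemma integrableOn_playerOutflow (hu : ∀ j, IsRate H M (u j)) (hν : 0 < ν) (j : P) {s : Set ℝ}
    (hs : volume s ≠ ⊤) : IntegrableOn (playerOutflow τ ν u j) s := by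
  refine Measure.integrableOn_of_bounded (M := ν) hs
    (measurable_playerOutflow hu hν j).aestronglyMeasurable ?_
  filter_upwards with x
  rw [Real.norm_of_nonneg (playerOutflow_nonneg hu hν j x)]
  exact playerOutflow_le hu hν j x

/-- Flow of a player leaves the edge only after having spent the transit time there. -/
lemma cumulative_playerOutflow_le (hu : ∀ j, IsRate H M (u j)) (hν : 0 < ν) (hτ : 0 ≤ τ) (j : P)
    (θ : ℝ) : cumulative (playerOutflow τ ν u j) (θ + τ) ≤ cumulative (u j) θ := by
  have hU := IsRate.totalRate hu
  have hT := (hU.continuous_arrival (τ := τ) hν).measurable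
  have hφ := (hU.entry_mono (τ := τ) hν).measurable
  have hcum0 : 0 ≤ cumulative (u j) θ := by
    rw [(hu j).cumulative_eq]; exact integral_nonneg (hu j).nonneg
  rw [← ENNReal.ofReal_le_ofReal_iff hcum0,
    ← setLIntegral_Iic_eq_cumulative (playerOutflow_nonneg hu hν j)
      (fun x hx => playerOutflow_of_lt hu hν j (by linarith))
      (integrableOn_playerOutflow hu hν j (by simp)),
    ← setLIntegral_Iic_eq_cumulative (hu j).nonneg
      (fun x hx => (hu j).eq_zero x (by simp; intro; linarith)) (hu j).integrable.integrableOn]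
  -- With the player's share `k` as integrand, `map_arrival` changes variables from exit to entrance
  -- times. The inequality comes from the fact that whatever has left by `θ + τ` entered by `θ`.
  set k : ℝ → ENNReal := fun x => ENNReal.ofReal (u j x / totalRate u x) with hk
  have hkm : Measurable k := ((hu j).measurable.div hU.measurable).ennreal_ofReal
  have hkφ : Measurable fun x => k (entry τ ν (totalRate u) x) := hkm.comp hφ
  set y := θ + τ
  calc ∫⁻ x in Set.Iic y, ENNReal.ofReal (playerOutflow τ ν u j x)
      = ∫⁻ x in Set.Iic y, (ENNReal.ofReal (throughput τ ν (totalRate u) x) *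
          k (entry τ ν (totalRate u) x)) := by
        refine lintegral_congr fun x => ?_
        rw [hk, playerOutflow, mul_comm, ENNReal.ofReal_mul (hU.throughput_nonneg hν x)]
    _ = ∫⁻ x in Set.Iic y, k (entry τ ν (totalRate u) x)
          ∂rateMeasure (throughput τ ν (totalRate u)) := by
        rw [rateMeasure, setLIntegral_withDensity_eq_setLIntegral_mul _
          (hU.measurable_throughput hν).ennreal_ofReal hkφ measurableSet_Iic]
        rfl
    _ = ∫⁻ x in arrival τ ν (totalRate u) ⁻¹' Set.Iic y,
          k (entry τ ν (totalRate u) (arrival τ ν (totalRate u) x)) ∂rateMeasure (totalRate u) := by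
        rw [← hU.map_arrival hν hτ, setLIntegral_map measurableSet_Iic hkφ hT]
    _ = ∫⁻ x in arrival τ ν (totalRate u) ⁻¹' Set.Iic y, k x ∂rateMeasure (totalRate u) := by
        refine lintegral_congr_ae (ae_restrict_of_ae ?_)
        filter_upwards [hU.ae_entry_arrival hν hτ] with x hx
        rw [hx]
    _ ≤ ∫⁻ x in Set.Iic θ, k x ∂rateMeasure (totalRate u) := by
        refine lintegral_mono_set fun x hx => ?_
        have h1 := hU.le_arrival (τ := τ) hν x
        have h2 : arrival τ ν (totalRate u) x ≤ θ + τ := hx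
        exact Set.mem_Iic.2 (by linarith)
    _ = ∫⁻ x in Set.Iic θ, (ENNReal.ofReal (totalRate u x) * k x) := by
        rw [rateMeasure, setLIntegral_withDensity_eq_setLIntegral_mul _
          hU.measurable.ennreal_ofReal hkm measurableSet_Iic]
        rfl
    _ ≤ ∫⁻ x in Set.Iic θ, ENNReal.ofReal (u j x) := by
        refine lintegral_mono fun x => ?_
        rw [hk, ← ENNReal.ofReal_mul (hU.nonneg x)]
        refine ENNReal.ofReal_le_ofReal ?_
        rcases eq_or_ne (totalRate u x) 0 with h0 | h0
        · rw [h0, zero_mul]; exact (hu j).nonneg x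
        · rw [mul_div_cancel₀ _ h0]

lemma entry_congr {M' : ℝ} (hU : IsRate H M U) (hU' : IsRate H M' U') (hν : 0 < ν) {c y : ℝ}
    (h : ∀ x ≤ c, arrival τ ν U x = arrival τ ν U' x) (hy : y ≤ c + τ) :
    entry τ ν U y = entry τ ν U' y := by
  unfold entry
  congr 1
  ext x
  rw [Set.mem_ofPred_eq, Set.mem_ofPred_eq]
  rcases le_or_gt x c with hx | hx
  · rw [h x hx]
  · have h1 := hU.le_arrival (τ := τ) hν x
    have h2 := hU'.le_arrival (τ := τ) hν x
    constructor <;> intro h3 <;> linarith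

lemma totalRate_ae_congr {c : ℝ} (h : ∀ j, ∀ᵐ x ∂volume.restrict (Set.Ico 0 c), u j x = u' j x) :
    ∀ᵐ x ∂volume.restrict (Set.Ico 0 c), totalRate u x = totalRate u' x := by
  filter_upwards [ae_all_iff.2 h] with x hx
  exact Finset.sum_congr rfl fun j _ => hx j

/-- Outside of a null set of exit times, the entrance time avoids a given null set. -/
lemma IsRate.ae_entry (hU : IsRate H M U) (hν : 0 < ν) {p : ℝ → Prop} (h : ∀ᵐ x, p x) :
    ∀ᵐ y, p (entry τ ν U y) := by
  have := hU.arrival_image_null (τ := τ) hν (N := {x | ¬ p x}) h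
  rw [ae_iff]
  refine measure_mono_null (fun y hy => ?_) this
  exact ⟨entry τ ν U y, hy, hU.arrival_entry hν y⟩

/-- The outflow until time `c + τ` depends only on the inflow until time `c`. -/
lemma playerOutflow_ae_congr {M' : ℝ} (hu : ∀ j, IsRate H M (u j))
    (hu' : ∀ j, IsRate H M' (u' j)) (hν : 0 < ν)
    {c : ℝ} (h : ∀ j, ∀ᵐ x ∂volume.restrict (Set.Ico 0 c), u j x = u' j x) (j : P) :
    ∀ᵐ y, y < c + τ → playerOutflow τ ν u j y = playerOutflow τ ν u' j y := by
  have hU := IsRate.totalRate hu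
  have hU' := IsRate.totalRate hu'
  have htot := totalRate_ae_congr h
  have hboth : ∀ᵐ x, x < c → u j x = u' j x ∧ totalRate u x = totalRate u' x := by
    have h1 := (ae_restrict_iff' measurableSet_Ico).1 ((h j).and htot)
    filter_upwards [h1] with x hx hxc
    rcases le_or_gt 0 x with h0 | h0
    · exact hx ⟨h0, hxc⟩
    · have hn : x ∉ Set.Ico 0 H := fun h => h0.not_ge h.1
      simp [(hu j).eq_zero x hn, (hu' j).eq_zero x hn, hU.eq_zero x hn, hU'.eq_zero x hn]
  have hshift := (measurePreserving_sub_right volume τ).quasiMeasurePreserving.ae hboth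
  filter_upwards [hU.ae_entry (τ := τ) hν hboth, hshift] with y hy hs hyc
  have hent : entry τ ν (totalRate u) y = entry τ ν (totalRate u') y :=
    entry_congr hU hU' hν (fun x hx => arrival_congr htot hx) hyc.le
  have hlt : entry τ ν (totalRate u) y < c := by
    have := hU.entry_le (τ := τ) hν y
    linarith
  rw [playerOutflow, playerOutflow, ← hent, (hy hlt).1, (hy hlt).2, throughput, throughput,
    queueLength_congr htot (by linarith), (hs (by linarith)).2]

end Merging

/-! ### Local perturbation estimate and continuation principles. -/

/-- The exit times of two inflows that agree until time `c` and differ by at most `K` until time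
`c + δ`. -/
lemma IsRate.abs_arrival_sub_le_of_ae {H M M' ν τ : ℝ} {U U' : ℝ → ℝ} (hU : IsRate H M U)
    (hU' : IsRate H M' U') (hν : 0 < ν) {c δ K θ : ℝ}
    (h : ∀ᵐ x ∂volume.restrict (Set.Ico 0 c), U x = U' x) (hK0 : 0 ≤ K) (hδ : 0 ≤ δ)
    (hK : ∀ᵐ x ∂volume.restrict (Set.Ico c (c + δ)), |U x - U' x| ≤ K) (hθ : θ ≤ c + δ) :
    |arrival τ ν U θ - arrival τ ν U' θ| ≤ 2 / ν * (K * δ) := by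
  refine hU.abs_arrival_sub_le hU' hν fun s hs => ?_
  rcases le_total s c with hsc | hsc
  · rw [IsRate.cumulative_congr h hsc, sub_self, abs_zero]
    positivity
  · have h1 := hU.cumulative_sub hsc
    have h2 := hU'.cumulative_sub hsc
    have h3 := IsRate.cumulative_congr h le_rfl
    have h4 : cumulative U s - cumulative U' s = ∫ x in Set.Ico c s, (U x - U' x) := by
      rw [integral_sub hU.integrable.integrableOn hU'.integrable.integrableOn,
        ← integral_Icc_eq_integral_Ico, ← integral_Icc_eq_integral_Ico,
        integral_Icc_eq_integral_Ioc, integral_Icc_eq_integral_Ioc]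
      linarith
    have h5 := norm_setIntegral_le_of_norm_le_const_ae (μ := volume) (s := Set.Ico c s)
      (f := fun x => U x - U' x) (C := K) (by simp)
      (ae_restrict_of_ae_restrict_of_subset (Set.Ico_subset_Ico_right (hs.trans hθ)) hK)
    rw [← h4, Real.norm_eq_abs] at h5
    refine h5.trans ?_
    rw [Measure.real, Real.volume_Ico, ENNReal.toReal_ofReal (by linarith)]
    exact mul_le_mul_of_nonneg_left (by linarith) hK0

/-- A property of initial intervals that is closed under limits and extends a little further from
every point holds everywhere. -/
lemma continuation {a : ℝ} (ha : 0 ≤ a) {p : ℝ → Prop} (h0 : p 0)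
    (hmono : ∀ x y, x ≤ y → p y → p x)
    (hsup : ∀ c ∈ Set.Ioc 0 a, (∀ c' ∈ Set.Ico 0 c, p c') → p c)
    (hstep : ∀ c ∈ Set.Ico 0 a, p c → ∃ c' > c, p c') : p a := by
  set S := {c | c ∈ Set.Icc 0 a ∧ p c} with hS
  have hne : S.Nonempty := ⟨0, ⟨le_rfl, ha⟩, h0⟩
  have hbd : BddAbove S := ⟨a, fun c hc => hc.1.2⟩
  have hs0 : 0 ≤ sSup S := le_csSup hbd ⟨⟨le_rfl, ha⟩, h0⟩
  have hsa : sSup S ≤ a := csSup_le hne fun c hc => hc.1.2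
  have hp : p (sSup S) := by
    rcases hs0.eq_or_lt with h | h
    · rwa [← h]
    · refine hsup _ ⟨h, hsa⟩ fun c' hc' => ?_
      obtain ⟨x, hx, hlt⟩ := exists_lt_of_lt_csSup hne hc'.2
      exact hmono _ _ hlt.le hx.2
  rcases hsa.eq_or_lt with h | h
  · rwa [← h]
  · obtain ⟨c', hc', hpc⟩ := hstep _ ⟨hs0, h⟩ hp
    have hmin : min c' a ∈ S := ⟨⟨le_min (hs0.trans hc'.le) ha, min_le_right _ _⟩,
      hmono _ _ (min_le_left _ _) hpc⟩
    exact absurd (le_csSup hbd hmin) (not_le.2 (lt_min hc' h))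

/-- Only countably many null sets may be united, hence the exhaustion by `c - c / (n + 1)`. -/
lemma ae_restrict_Ico_of_forall_lt {c : ℝ} {p : ℝ → Prop} (hc : 0 < c)
    (h : ∀ c' ∈ Set.Ico 0 c, ∀ᵐ x ∂volume.restrict (Set.Ico 0 c'), p x) :
    ∀ᵐ x ∂volume.restrict (Set.Ico 0 c), p x := by
  have h1 : ∀ n : ℕ, ∀ᵐ x, x ∈ Set.Ico 0 (c - c / (n + 1)) → p x := fun n => by
    rw [← ae_restrict_iff' measurableSet_Ico]
    refine h _ ⟨?_, by have : 0 < c / (n + 1) := by positivity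
                       linarith⟩
    rw [sub_nonneg]
    exact div_le_self hc.le (by linarith [(n.cast_nonneg : (0 : ℝ) ≤ n)])
  rw [ae_restrict_iff' measurableSet_Ico]
  filter_upwards [ae_all_iff.2 h1] with x hx hmem
  obtain ⟨n, hn⟩ := exists_nat_gt (c / (c - x))
  refine hx n ⟨hmem.1, ?_⟩
  have hpos : 0 < c - x := sub_pos.2 hmem.2
  have : c / (n + 1) < c - x := by
    rw [div_lt_iff₀ (by positivity)]
    rw [div_lt_iff₀ hpos] at hn
    linarith
  linarith

lemma eventually_mul_le (k : ℝ) {r : ℝ} (hr : 0 < r) :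
    ∀ᶠ δ in nhdsWithin (0 : ℝ) (Set.Ioi 0), k * δ ≤ r := by
  have h : Filter.Tendsto (fun δ : ℝ => k * δ) (nhdsWithin 0 (Set.Ioi 0)) (nhds 0) := by
    have : Filter.Tendsto (fun δ : ℝ => k * δ) (nhds 0) (nhds (k * 0)) :=
      (continuous_const.mul continuous_id).tendsto 0
    rw [mul_zero] at this
    exact this.mono_left nhdsWithin_le_nhds
  exact (h.eventually_lt_const hr).mono fun _ h => h.le

/-! ### The network: causality, contraction estimate and uniqueness of rates. -/

namespace Game

variable {V E P : Type*} {G : Game V E P} {g : P → E → ℝ × (E → ℝ) → ℝ} {u u' : E → P → ℝ → ℝ}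

/-- The rates `u` and `u'` agree until time `c`. -/
def AgreeUntil (c : ℝ) (u u' : E → P → ℝ → ℝ) : Prop :=
  ∀ e j, ∀ᵐ x ∂volume.restrict (Set.Ico 0 c), u e j x = u' e j x

variable [Fintype P]

/-- Exit times of all edges under the inflow rates `u`. -/
def exitTimes (G : Game V E P) (u : E → P → ℝ → ℝ) (θ : ℝ) : E → ℝ :=
  fun e => arrival (G.τ e) (G.ν e) (totalRate (u e)) θ

lemma exitTimes_congr {c θ : ℝ} (h : AgreeUntil c u u') (hθ : θ ≤ c) :
    G.exitTimes u θ = G.exitTimes u' θ :=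
  funext fun e => arrival_congr (totalRate_ae_congr (h e)) hθ

variable [Fintype E]

/-- An upper bound on the inflow rates in a flow that follows a strategy profile. -/
def rateBound (G : Game V E P) : ℝ := ∑ e, G.ν e + ∑ j, G.d j

/-- All rates `u e j` are admissible. -/
def AreRates (G : Game V E P) (u : E → P → ℝ → ℝ) : Prop := ∀ e j, IsRate G.H G.rateBound (u e j)

lemma rateBound_nonneg : 0 ≤ G.rateBound :=
  add_nonneg (Finset.sum_nonneg fun e _ => (G.ν_pos e).le)
    (Finset.sum_nonneg fun j _ => (G.d_pos j).le)

lemma exitTimes_pos (hu : G.AreRates u) {θ : ℝ} (hθ : 0 ≤ θ) (e : E) :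
    0 < G.exitTimes u θ e := by
  have := (IsRate.totalRate (hu e)).le_arrival (τ := G.τ e) (G.ν_pos e) θ
  have := G.τ_pos e
  unfold exitTimes
  linarith

lemma info_mem (hu : G.AreRates u) {θ : ℝ} (hθ : θ ∈ Set.Ico 0 G.H) :
    (θ, G.exitTimes u θ) ∈ G.infoSet :=
  ⟨hθ, fun e => (exitTimes_pos hu hθ.1 e).le⟩

/-- Right-Lipschitz strategies are Lipschitz on a cube with a given lower corner. -/
lemma exists_lipschitz_cube (hL : ∀ j e, G.RightLipschitz (g j e)) {c : ℝ} {T : E → ℝ}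
    (hI : (c, T) ∈ G.infoSet) : ∃ L > 0, ∃ ε > 0, c + ε < G.H ∧
      ∀ j e, ∀ p ∈ Set.Icc (c, T) (c + ε, fun e => T e + ε),
        ∀ q ∈ Set.Icc (c, T) (c + ε, fun e => T e + ε), |g j e p - g j e q| ≤ L * ‖p - q‖ := by
  choose L hLpos ε hε hlip using fun j e => hL j e (c, T) hI
  have hsmall : ∀ᶠ η in nhdsWithin (0 : ℝ) (Set.Ioi 0), ∀ j e, 1 * η ≤ ε j e :=
    Filter.eventually_all.2 fun j => Filter.eventually_all.2 fun e => eventually_mul_le 1 (hε j e)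
  have hH : ∀ᶠ η in nhdsWithin (0 : ℝ) (Set.Ioi 0), 1 * η ≤ (G.H - c) / 2 :=
    eventually_mul_le 1 (half_pos (sub_pos.2 hI.1.2))
  obtain ⟨η, ⟨hη, hηH⟩, hη0⟩ := ((hsmall.and hH).and self_mem_nhdsWithin).exists
  replace hη0 : 0 < η := hη0
  have hc := hI.1.2
  simp only at hc
  -- The sum dominates all finitely many local constants; the summand `1` keeps it positive when
  -- there are no players or edges.
  refine ⟨1 + ∑ j, ∑ e, L j e, ?_, η, hη0, by linarith, fun j e p hp q hq => ?_⟩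
  · have : 0 ≤ ∑ j, ∑ e, L j e :=
      Finset.sum_nonneg fun j _ => Finset.sum_nonneg fun e _ => (hLpos j e).le
    positivity
  · have hle : L j e ≤ 1 + ∑ j, ∑ e, L j e := by
      have h1 := Finset.single_le_sum (f := fun e => L j e) (fun e _ => (hLpos j e).le)
        (Finset.mem_univ e)
      have h2 := Finset.single_le_sum (f := fun j => ∑ e, L j e)
        (fun j _ => Finset.sum_nonneg fun e _ => (hLpos j e).le) (Finset.mem_univ j)
      linarith
    have hmem : ∀ p ∈ Set.Icc (c, T) (c + η, fun e => T e + η), p ∈ G.infoSet ∧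
        p - (c, T) ∈ Set.Icc (0 : ℝ × (E → ℝ)) (ε j e, fun _ => ε j e) := by
      rintro ⟨a, x⟩ ⟨⟨ha1, hx1⟩, ⟨ha2, hx2⟩⟩
      have hb := hη j e
      have hI1 := hI.1.1
      have hI2 := hI.2
      replace ha1 : c ≤ a := ha1
      replace ha2 : a ≤ c + η := ha2
      replace hI1 : 0 ≤ c := hI1
      refine ⟨⟨⟨by simp only; linarith, by simp only; linarith⟩,
        fun i => (hI2 i).trans (hx1 i)⟩, ⟨?_, ?_⟩, ⟨?_, ?_⟩⟩
      · simpa using ha1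
      · intro i; have := hx1 i; simpa using this
      · simp only [Prod.fst_sub]; linarith
      · intro i
        have h1 : x i ≤ T i + η := hx2 i
        simp only [Prod.snd_sub, Pi.sub_apply]
        linarith
    obtain ⟨hp1, hp2⟩ := hmem p hp
    obtain ⟨hq1, hq2⟩ := hmem q hq
    have key := hlip j e _ hp2 _ hq2 (by rwa [add_sub_cancel]) (by rwa [add_sub_cancel])
    rw [add_sub_cancel, add_sub_cancel, sub_sub_sub_cancel_right] at key
    exact key.trans (mul_le_mul_of_nonneg_right hle (norm_nonneg _))

/-- Monotone exit times never leave through the lower faces of the cube, and their Lipschitz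
constant keeps them below the upper faces for time `δ`. -/
lemma exitTimes_mem_cube (hu : G.AreRates u) {c δ ε θ : ℝ}
    (hδ : ∀ e, (1 + Fintype.card P * G.rateBound / G.ν e) * δ ≤ ε)
    (hθ : θ ∈ Set.Icc c (c + δ)) :
    G.exitTimes u θ ∈ Set.Icc (G.exitTimes u c) (fun e => G.exitTimes u c e + ε) := by
  refine ⟨fun e => (IsRate.totalRate (hu e)).arrival_mono (G.ν_pos e) hθ.1, fun e => ?_⟩
  have h1 := (IsRate.totalRate (hu e)).arrival_sub_le (τ := G.τ e) (G.ν_pos e) hθ.1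
  have h2 : (1 + Fintype.card P * G.rateBound / G.ν e) * (θ - c) ≤
      (1 + Fintype.card P * G.rateBound / G.ν e) * δ := by
    refine mul_le_mul_of_nonneg_left (by linarith [hθ.2]) ?_
    have := rateBound_nonneg (G := G)
    have := G.ν_pos e
    positivity
  have h3 := hδ e
  unfold exitTimes
  linarith

/-- A step size for which the local fixed point map is a contraction. -/
lemma exists_step (G : Game V E P) {a ε : ℝ} (L : ℝ) (ha : 0 < a) (hε : 0 < ε) :
    ∃ δ > 0, δ ≤ a ∧ δ ≤ ε ∧ (∀ e, δ ≤ G.τ e) ∧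
      (∀ e, (1 + Fintype.card P * G.rateBound / G.ν e) * δ ≤ ε) ∧
      ∀ e, 2 / G.ν e * (Fintype.card P * (L * G.rateBound)) * δ ≤ 1 / 2 := by
  have h1 : ∀ᶠ δ in nhdsWithin (0 : ℝ) (Set.Ioi 0), ∀ e, 1 * δ ≤ G.τ e :=
    Filter.eventually_all.2 fun e => eventually_mul_le 1 (G.τ_pos e)
  have h2 : ∀ᶠ δ in nhdsWithin (0 : ℝ) (Set.Ioi 0),
      ∀ e, (1 + Fintype.card P * G.rateBound / G.ν e) * δ ≤ ε :=
    Filter.eventually_all.2 fun e => eventually_mul_le _ hε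
  have h3 : ∀ᶠ δ in nhdsWithin (0 : ℝ) (Set.Ioi 0),
      ∀ e, 2 / G.ν e * (Fintype.card P * (L * G.rateBound)) * δ ≤ 1 / 2 :=
    Filter.eventually_all.2 fun e => eventually_mul_le _ (by norm_num)
  obtain ⟨δ, ⟨⟨⟨⟨h1, h2⟩, h3⟩, h4⟩, h5⟩, h0⟩ :=
    (((((h1.and h2).and h3).and (eventually_mul_le 1 ha)).and
      (eventually_mul_le 1 hε)).and self_mem_nhdsWithin).exists
  simp only [one_mul] at h1 h4 h5
  exact ⟨δ, h0, h4, h5, h1, h2, h3⟩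

/-- Contraction estimate for the exit times. -/
lemma norm_exitTimes_sub_le (hu : G.AreRates u) (hu' : G.AreRates u') {c δ L D θ : ℝ}
    (hδ0 : 0 ≤ δ) (hL0 : 0 ≤ L) (hD : 0 ≤ D)
    (hδ : ∀ e, 2 / G.ν e * (Fintype.card P * (L * G.rateBound)) * δ ≤ 1 / 2)
    (h : AgreeUntil c u u')
    (hdiff : ∀ e j, ∀ᵐ x ∂volume.restrict (Set.Ico c (c + δ)),
      |u e j x - u' e j x| ≤ L * D * G.rateBound) (hθ : θ ≤ c + δ) :
    ‖G.exitTimes u θ - G.exitTimes u' θ‖ ≤ D / 2 := by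
  rw [pi_norm_le_iff_of_nonneg (by positivity)]
  intro e
  have hM := rateBound_nonneg (G := G)
  have h1 := (IsRate.totalRate (hu e)).abs_arrival_sub_le_of_ae (τ := G.τ e)
    (IsRate.totalRate (hu' e)) (G.ν_pos e) (c := c) (δ := δ)
    (K := Fintype.card P * (L * D * G.rateBound)) (θ := θ)
    (totalRate_ae_congr (h e)) (by positivity) hδ0 ?_ hθ
  · rw [Real.norm_eq_abs]
    refine h1.trans ?_
    have := mul_le_mul_of_nonneg_right (hδ e) hD
    linarith
  · filter_upwards [ae_all_iff.2 (hdiff e)] with x hx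
    unfold totalRate
    rw [← Finset.sum_sub_distrib]
    refine (Finset.abs_sum_le_sum_abs _ _).trans ?_
    have := Finset.sum_le_card_nsmul Finset.univ (fun j => |u e j x - u' e j x|) _
      fun j _ => hx j
    simpa using this

variable [DecidableEq V]

/-- Rate at which flow of player `j` arrives or originates at node `v`. -/
def nodeInflow (G : Game V E P) (u : E → P → ℝ → ℝ) (v : V) (j : P) (θ : ℝ) : ℝ :=
  ∑ e ∈ G.inEdges v, playerOutflow (G.τ e) (G.ν e) (u e) j θ + if v = G.s j then G.d j else 0

/-- Inflow rates prescribed by the strategy profile `g` if the inflow rates so far are `u`. -/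
def response (G : Game V E P) (g : P → E → ℝ × (E → ℝ) → ℝ) (u : E → P → ℝ → ℝ) (e : E) (j : P) (θ : ℝ) : ℝ :=
  if G.tail e = G.t j then 0 else g j e (θ, G.exitTimes u θ) * G.nodeInflow u (G.tail e) j θ

/-- The inflow rates `u` follow the strategy profile `g` until time `a`. -/
structure FollowsUntil (G : Game V E P) (g : P → E → ℝ × (E → ℝ) → ℝ) (a : ℝ) (u : E → P → ℝ → ℝ) : Prop where
  rates : G.AreRates u
  eq_response : ∀ e j, ∀ᵐ θ ∂volume.restrict (Set.Ico 0 a), u e j θ = G.response g u e j θ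

lemma nodeInflow_nonneg (hu : G.AreRates u) (v : V) (j : P) (θ : ℝ) :
    0 ≤ G.nodeInflow u v j θ := by
  refine add_nonneg (Finset.sum_nonneg fun e _ => playerOutflow_nonneg (hu e) (G.ν_pos e) j θ) ?_
  split_ifs
  · exact (G.d_pos j).le
  · exact le_rfl

/-- Stated for arbitrary edge rates, as it also bounds the outflow of a feasible flow not yet known
to be of the form `playerOutflow`. -/
lemma sum_add_supply_le (v : V) (j : P) {w : E → ℝ} (hw : ∀ e, w e ≤ G.ν e) :
    ∑ e ∈ G.inEdges v, w e + (if v = G.s j then G.d j else 0) ≤ G.rateBound := by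
  refine add_le_add ?_ ?_
  · refine (Finset.sum_le_sum fun e _ => hw e).trans ?_
    exact Finset.sum_le_univ_sum_of_nonneg fun e => (G.ν_pos e).le
  · have h := Finset.single_le_sum (f := G.d) (fun i _ => (G.d_pos i).le) (Finset.mem_univ j)
    split_ifs
    · exact h
    · exact Finset.sum_nonneg fun i _ => (G.d_pos i).le

lemma nodeInflow_le (hu : G.AreRates u) (v : V) (j : P) (θ : ℝ) :
    G.nodeInflow u v j θ ≤ G.rateBound :=
  sum_add_supply_le v j fun e => playerOutflow_le (hu e) (G.ν_pos e) j θ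

lemma measurable_nodeInflow (hu : G.AreRates u) (v : V) (j : P) :
    Measurable (G.nodeInflow u v j) :=
  (Finset.measurable_fun_sum _ fun e _ =>
    measurable_playerOutflow (hu e) (G.ν_pos e) j).add_const _

lemma nodeInflow_ae_congr (hu : G.AreRates u) (hu' : G.AreRates u') {c : ℝ}
    (h : AgreeUntil c u u') (v : V) (j : P) :
    ∀ᵐ θ, (∀ e, θ < c + G.τ e) → G.nodeInflow u v j θ = G.nodeInflow u' v j θ := by
  have h1 : ∀ e, ∀ᵐ θ, θ < c + G.τ e →
      playerOutflow (G.τ e) (G.ν e) (u e) j θ = playerOutflow (G.τ e) (G.ν e) (u' e) j θ :=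
    fun e => playerOutflow_ae_congr (hu e) (hu' e) (G.ν_pos e) (h e) j
  filter_upwards [ae_all_iff.2 h1] with θ hθ hlt
  unfold nodeInflow
  rw [Finset.sum_congr rfl fun e _ => hθ e (hlt e)]

lemma response_ae_congr (hu : G.AreRates u) (hu' : G.AreRates u') {c : ℝ}
    (h : AgreeUntil c u u') (e : E) (j : P) :
    ∀ᵐ θ, θ < c → G.response g u e j θ = G.response g u' e j θ := by
  filter_upwards [nodeInflow_ae_congr hu hu' h (G.tail e) j] with θ hθ hlt
  unfold response
  rw [exitTimes_congr h hlt.le, hθ fun e => by linarith [G.τ_pos e]]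

lemma FollowsUntil.mono {a b : ℝ} (h : G.FollowsUntil g b u) (hab : a ≤ b) :
    G.FollowsUntil g a u :=
  ⟨h.rates, fun e j =>
    ae_restrict_of_ae_restrict_of_subset (Set.Ico_subset_Ico_right hab) (h.eq_response e j)⟩

/-- The node inflow is the same in both terms: on a step no longer than the transit times it is
already determined, and only the observed exit times vary. -/
lemma abs_response_sub_le (hu' : G.AreRates u')
    {L s θ : ℝ} {T T' : E → ℝ} (hL0 : 0 ≤ L) (e : E) (j : P)
    (h : |g j e (s, T) - g j e (s, T')| ≤ L * ‖(s, T) - (s, T')‖) {D : ℝ}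
    (hD : ‖T - T'‖ ≤ D) :
    |(if G.tail e = G.t j then 0 else g j e (s, T) * G.nodeInflow u' (G.tail e) j θ) -
      (if G.tail e = G.t j then 0 else g j e (s, T') * G.nodeInflow u' (G.tail e) j θ)| ≤
      L * D * G.rateBound := by
  have hM := rateBound_nonneg (G := G)
  have hD0 := (norm_nonneg _).trans hD
  split_ifs
  · rw [sub_self, abs_zero]; positivity
  · rw [← sub_mul, abs_mul, abs_of_nonneg (nodeInflow_nonneg hu' _ _ _)]
    have h1 : ‖(s, T) - (s, T')‖ = ‖T - T'‖ := by
      rw [Prod.mk_sub_mk, sub_self, Prod.norm_mk, norm_zero, max_eq_right (norm_nonneg _)]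
    rw [h1] at h
    exact mul_le_mul (h.trans (mul_le_mul_of_nonneg_left hD hL0)) (nodeInflow_le hu' _ _ _)
      (nodeInflow_nonneg hu' _ _ _) (by positivity)

/-- Inflow rates that follow a given strategy profile are unique. -/
lemma FollowsUntil.agree (hL : ∀ j e, G.RightLipschitz (g j e)) {a : ℝ} (ha0 : 0 ≤ a)
    (ha : a ≤ G.H) (hu : G.FollowsUntil g a u) (hu' : G.FollowsUntil g a u') :
    AgreeUntil a u u' := by
  refine continuation (p := fun c => AgreeUntil c u u') ha0 ?_ ?_ ?_ ?_
  · intro e j; simp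
  · intro x y hxy h e j
    exact ae_restrict_of_ae_restrict_of_subset (Set.Ico_subset_Ico_right hxy) (h e j)
  · intro c hc h e j
    exact ae_restrict_Ico_of_forall_lt hc.1 fun c' hc' => h c' hc' e j
  · intro c hc h
    have hTc := exitTimes_congr (G := G) h le_rfl
    obtain ⟨L, hL0, ε, hε, -, hlip⟩ := exists_lipschitz_cube hL
      (info_mem hu.rates ⟨hc.1, hc.2.trans_le ha⟩)
    obtain ⟨δ, hδ, hδa, hδε, hδτ, hδcube, hδcontr⟩ :=
      G.exists_step L (sub_pos.2 hc.2) hε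
    refine ⟨c + δ, by linarith, ?_⟩
    have hcube : ∀ θ ∈ Set.Icc c (c + δ), G.exitTimes u θ ∈
        Set.Icc (G.exitTimes u c) (fun e => G.exitTimes u c e + ε) := fun θ hθ =>
      exitTimes_mem_cube hu.rates hδcube hθ
    have hcube' : ∀ θ ∈ Set.Icc c (c + δ), G.exitTimes u' θ ∈
        Set.Icc (G.exitTimes u c) (fun e => G.exitTimes u c e + ε) := fun θ hθ => by
      rw [hTc]; exact exitTimes_mem_cube hu'.rates hδcube hθ
    have hdiff : ∀ D, (∀ θ ∈ Set.Icc c (c + δ), ‖G.exitTimes u θ - G.exitTimes u' θ‖ ≤ D) →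
        ∀ e j, ∀ᵐ x ∂volume.restrict (Set.Ico c (c + δ)),
          |u e j x - u' e j x| ≤ L * D * G.rateBound := by
      intro D hD e j
      have h1 := (ae_restrict_iff' measurableSet_Ico).1 (hu.eq_response e j)
      have h2 := (ae_restrict_iff' measurableSet_Ico).1 (hu'.eq_response e j)
      rw [ae_restrict_iff' measurableSet_Ico]
      filter_upwards [h1, h2, nodeInflow_ae_congr hu.rates hu'.rates h (G.tail e) j]
        with x hx1 hx2 hx3 hx
      have hx0 : x ∈ Set.Ico 0 a := ⟨hc.1.trans hx.1, by linarith [hx.2]⟩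
      have hxc : x ∈ Set.Icc c (c + δ) := ⟨hx.1, hx.2.le⟩
      rw [hx1 hx0, hx2 hx0, response, response, hx3 fun e => by linarith [hx.2, hδτ e]]
      refine abs_response_sub_le hu'.rates hL0.le e j (hlip j e _ ?_ _ ?_) (hD x hxc)
      · exact ⟨⟨hx.1, (hcube x hxc).1⟩, ⟨by simp only; linarith [hx.2], (hcube x hxc).2⟩⟩
      · exact ⟨⟨hx.1, (hcube' x hxc).1⟩, ⟨by simp only; linarith [hx.2], (hcube' x hxc).2⟩⟩
    -- Both families of exit times lie in one cube of side `ε`. Passing from exit times to rates and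
    -- back halves any bound on their distance, so iteration forces them to coincide.
    have hn : ∀ n : ℕ, ∀ θ ∈ Set.Icc c (c + δ),
        ‖G.exitTimes u θ - G.exitTimes u' θ‖ ≤ ε * (1 / 2) ^ n := by
      intro n
      induction n with
      | zero =>
        intro θ hθ
        rw [pow_zero, mul_one, pi_norm_le_iff_of_nonneg hε.le]
        intro e
        have h1 := (hcube θ hθ).1 e
        have h2 := (hcube θ hθ).2 e
        have h3 := (hcube' θ hθ).1 e
        have h4 := (hcube' θ hθ).2 e
        rw [Real.norm_eq_abs, Pi.sub_apply, abs_le]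
        simp only at h2 h4
        constructor <;> linarith
      | succ n ih =>
        intro θ hθ
        have := norm_exitTimes_sub_le hu.rates hu'.rates hδ.le hL0.le (by positivity) hδcontr h
          (hdiff _ ih) hθ.2
        rw [pow_succ]
        linarith
    have hzero : ∀ θ ∈ Set.Icc c (c + δ), ‖G.exitTimes u θ - G.exitTimes u' θ‖ ≤ 0 := by
      intro θ hθ
      have := (tendsto_pow_atTop_nhds_zero_of_lt_one (r := (1 / 2 : ℝ)) (by norm_num)
        (by norm_num)).const_mul ε
      rw [mul_zero] at this
      exact ge_of_tendsto' this fun n => hn n θ hθ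
    intro e j
    rw [← Set.Ico_union_Ico_eq_Ico hc.1 (by linarith : c ≤ c + δ), ae_restrict_union_iff]
    refine ⟨h e j, ?_⟩
    -- Equal exit times and equal node inflows prescribe equal rates.
    filter_upwards [hdiff 0 hzero e j] with x hx
    rw [mul_zero, zero_mul] at hx
    exact sub_eq_zero.1 (abs_nonpos_iff.1 hx)

end Game

/-! ### Existence of rates that follow the profile. -/

namespace Game

variable {V E P : Type*} {G : Game V E P} {g : P → E → ℝ × (E → ℝ) → ℝ} {u u' : E → P → ℝ → ℝ}

/-- Componentwise truncation to the cube with lower corner `T` and side length `ε`. -/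
def clamp (T : E → ℝ) (ε : ℝ) (x : E → ℝ) : E → ℝ := fun e => max (T e) (min (x e) (T e + ε))

lemma clamp_mem (T : E → ℝ) {ε : ℝ} (hε : 0 ≤ ε) (x : E → ℝ) :
    clamp T ε x ∈ Set.Icc T (fun e => T e + ε) :=
  ⟨fun e => le_max_left _ _, fun e => max_le (by linarith) (min_le_right _ _)⟩

lemma clamp_of_mem {T : E → ℝ} {ε : ℝ} {x : E → ℝ} (hx : x ∈ Set.Icc T (fun e => T e + ε)) :
    clamp T ε x = x := by
  ext e
  rw [clamp, min_eq_left (hx.2 e), max_eq_right (hx.1 e)]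

lemma clamp_mem_cube {c ε : ℝ} (hε : 0 ≤ ε) (T y : E → ℝ) (θ : ℝ) :
    (max c (min θ (c + ε)), clamp T ε y) ∈ Set.Icc (c, T) (c + ε, fun e => T e + ε) :=
  ⟨⟨le_max_left _ _, (clamp_mem T hε y).1⟩,
    ⟨max_le (by linarith) (min_le_right _ _), (clamp_mem T hε y).2⟩⟩

lemma cube_subset_infoSet {c ε : ℝ} {T : E → ℝ} (hI : (c, T) ∈ G.infoSet) (hεH : c + ε < G.H) :
    Set.Icc (c, T) (c + ε, fun e => T e + ε) ⊆ G.infoSet := by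
  rintro ⟨a, y⟩ ⟨⟨h1, h2⟩, ⟨h3, -⟩⟩
  have h4 : 0 ≤ c := hI.1.1
  replace h1 : c ≤ a := h1
  replace h3 : a ≤ c + ε := h3
  exact ⟨⟨h4.trans h1, h3.trans_lt hεH⟩, fun e => (hI.2 e).trans (h2 e)⟩

variable [Fintype E]

lemma norm_clamp_sub_le (T : E → ℝ) (ε : ℝ) (x y : E → ℝ) :
    ‖clamp T ε x - clamp T ε y‖ ≤ ‖x - y‖ := by
  rw [pi_norm_le_iff_of_nonneg (norm_nonneg _)]
  intro e
  refine le_trans ?_ (norm_le_pi_norm (x - y) e)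
  rw [Pi.sub_apply, Pi.sub_apply, Real.norm_eq_abs, Real.norm_eq_abs]
  refine (abs_max_sub_max_le_max _ _ _ _).trans ?_
  rw [sub_self, abs_zero]
  refine max_le (abs_nonneg _) ((abs_min_sub_min_le_max _ _ _ _).trans ?_)
  rw [sub_self, abs_zero]
  exact max_le le_rfl (abs_nonneg _)

variable [Fintype P] [DecidableEq V]

/-- The inflow rates `u` until time `c`, continued until time `c + δ` as prescribed by the strategy
profile `g` when the exit times are `x`. -/
def extension (G : Game V E P) (g : P → E → ℝ × (E → ℝ) → ℝ) (u : E → P → ℝ → ℝ) (c δ ε : ℝ)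
    (x : ℝ → E → ℝ) (e : E) (j : P) (θ : ℝ) : ℝ :=
  if θ < c then u e j θ
  else if θ < c + δ then
    if G.tail e = G.t j then 0
    else g j e (max c (min θ (c + ε)), clamp (G.exitTimes u c) ε (x θ)) *
      G.nodeInflow u (G.tail e) j θ
  else 0

section Extension

variable {c δ ε L : ℝ} {x x' : ℝ → E → ℝ}

lemma extension_of_lt {θ : ℝ} (hθ : θ < c) (e : E) (j : P) :
    G.extension g u c δ ε x e j θ = u e j θ := if_pos hθ

lemma extension_of_mem {θ : ℝ} (hθ : θ ∈ Set.Ico c (c + δ)) (e : E) (j : P) :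
    G.extension g u c δ ε x e j θ = if G.tail e = G.t j then 0
    else g j e (max c (min θ (c + ε)), clamp (G.exitTimes u c) ε (x θ)) *
      G.nodeInflow u (G.tail e) j θ := by
  rw [extension, if_neg hθ.1.not_gt, if_pos hθ.2]

lemma extension_agree (G : Game V E P) (g : P → E → ℝ × (E → ℝ) → ℝ) (u : E → P → ℝ → ℝ)
    (c δ ε : ℝ) (x : ℝ → E → ℝ) : AgreeUntil c u (G.extension g u c δ ε x) := fun e j => by
  filter_upwards [ae_restrict_mem measurableSet_Ico] with θ hθ
  rw [extension_of_lt hθ.2]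

/-- After truncation the information runs through the cube along a continuous curve `κ`. The
strategy is continuous on the cube, so its values along the curve are measurable. -/
lemma extension_rates (hg : ∀ j, G.IsStrategy j (g j)) (hu : G.AreRates u)
    (hc : c ∈ Set.Ico 0 G.H) (hε : 0 ≤ ε) (hεH : c + ε < G.H) (hδε : δ ≤ ε)
    (hlip : ∀ j e, ∀ p ∈ Set.Icc (c, G.exitTimes u c) (c + ε, fun e => G.exitTimes u c e + ε),
        ∀ q ∈ Set.Icc (c, G.exitTimes u c) (c + ε, fun e => G.exitTimes u c e + ε),
          |g j e p - g j e q| ≤ L * ‖p - q‖)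
    (hx : Continuous x) : G.AreRates (G.extension g u c δ ε x) := by
  intro e j
  set κ : ℝ → ℝ × (E → ℝ) :=
    fun θ => (max c (min θ (c + ε)), clamp (G.exitTimes u c) ε (x θ)) with hκ
  have hκmem : ∀ θ, κ θ ∈ Set.Icc (c, G.exitTimes u c) (c + ε, fun e => G.exitTimes u c e + ε) :=
    fun θ => clamp_mem_cube hε _ _ θ
  have hκcont : Continuous κ := by
    refine Continuous.prodMk (by fun_prop) ?_
    unfold clamp
    fun_prop
  have hgcont : ContinuousOn (g j e)
      (Set.Icc (c, G.exitTimes u c) (c + ε, fun e => G.exitTimes u c e + ε)) := by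
    refine LipschitzOnWith.continuousOn (K := Real.toNNReal L)
      (LipschitzOnWith.of_dist_le_mul fun p hp q hq => ?_)
    rw [Real.dist_eq, dist_eq_norm]
    exact (hlip j e p hp q hq).trans
      (mul_le_mul_of_nonneg_right (Real.le_coe_toNNReal L) (norm_nonneg _))
  have hgκ : Continuous fun θ => g j e (κ θ) := hgcont.comp_continuous hκcont hκmem
  have hgI : ∀ θ, g j e (κ θ) ∈ Set.Icc 0 1 := fun θ =>
    (hg j).mem_Icc e _ (cube_subset_infoSet (info_mem hu hc) hεH (hκmem θ))
  have hM := rateBound_nonneg (G := G)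
  refine ⟨?_, fun θ => ?_, fun θ => ?_, fun θ hθ => ?_⟩
  · refine Measurable.ite measurableSet_Iio (hu e j).measurable
      (Measurable.ite measurableSet_Iio ?_ measurable_const)
    by_cases ht : G.tail e = G.t j
    · simp only [ht, if_true]; exact measurable_const
    · simp only [ht, if_false]
      exact hgκ.measurable.mul (measurable_nodeInflow hu _ _)
  · unfold extension
    split_ifs
    · exact (hu e j).nonneg θ
    · exact le_rfl
    · exact mul_nonneg (hgI θ).1 (nodeInflow_nonneg hu _ _ _)
    · exact le_rfl
  · unfold extension
    split_ifs
    · exact (hu e j).le θ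
    · exact hM
    · refine le_trans (mul_le_of_le_one_left (nodeInflow_nonneg hu _ _ _) (hgI θ).2)
        (nodeInflow_le hu _ _ _)
    · exact hM
  · rw [Set.mem_Ico, not_and_or, not_le, not_lt] at hθ
    rcases hθ with h | h
    · rw [extension_of_lt (h.trans_le hc.1), (hu e j).eq_zero θ fun h' => h.not_ge h'.1]
    · rw [extension, if_neg (by linarith [hc.2]), if_neg (by linarith)]

end Extension

/-- Inflow rates that follow a strategy profile until some time can be continued. -/
lemma FollowsUntil.exists_extension (hg : ∀ j, G.IsStrategy j (g j))
    (hL : ∀ j e, G.RightLipschitz (g j e)) {c : ℝ} (hc : c ∈ Set.Ico 0 G.H)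
    (hu : G.FollowsUntil g c u) : ∃ c' > c, ∃ u', G.FollowsUntil g c' u' := by
  obtain ⟨L, hL0, ε, hε, hεH, hlip⟩ := exists_lipschitz_cube hL (info_mem hu.rates hc)
  obtain ⟨δ, hδ, -, hδε, hδτ, hδcube, hδcontr⟩ := G.exists_step L one_pos hε
  have hle : c ≤ c + δ := by linarith
  let ext (T : C(Set.Icc c (c + δ), E → ℝ)) : E → P → ℝ → ℝ :=
    G.extension g u c δ ε (Set.IccExtend hle T)
  have hrates : ∀ T, G.AreRates (ext T) := fun T =>
    extension_rates hg hu.rates hc hε.le hεH hδε hlip (T.continuous.Icc_extend' )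
  let Φ (T : C(Set.Icc c (c + δ), E → ℝ)) : C(Set.Icc c (c + δ), E → ℝ) :=
    ⟨fun θ => G.exitTimes (ext T) θ, by
      refine continuous_pi fun e => ?_
      exact ((IsRate.totalRate (hrates T e)).continuous_arrival (G.ν_pos e)).comp
        continuous_subtype_val⟩
  have hagree : ∀ T T', AgreeUntil c (ext T) (ext T') := fun T T' e j => by
    filter_upwards [extension_agree G g u c δ ε (Set.IccExtend hle T) e j,
      extension_agree G g u c δ ε (Set.IccExtend hle T') e j] with θ h1 h2
    exact h1.symm.trans h2
  have hcontr : ContractingWith (1 / 2) Φ := by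
    refine ⟨by norm_num, LipschitzWith.of_dist_le_mul fun T T' => ?_⟩
    rw [ContinuousMap.dist_le (by positivity)]
    intro θ
    rw [dist_eq_norm]
    have h := norm_exitTimes_sub_le (hrates T) (hrates T') (θ := θ) (D := dist T T') hδ.le hL0.le
      dist_nonneg hδcontr (hagree T T') ?_ θ.2.2
    · refine h.trans (le_of_eq ?_)
      push_cast
      ring
    · intro e j
      filter_upwards [ae_restrict_mem measurableSet_Ico] with x hx
      have hx' : x ∈ Set.Icc c (c + δ) := ⟨hx.1, hx.2.le⟩
      have hdist : ‖Set.IccExtend hle T x - Set.IccExtend hle T' x‖ ≤ dist T T' := by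
        rw [Set.IccExtend_of_mem hle _ hx', Set.IccExtend_of_mem hle _ hx', ← dist_eq_norm]
        exact ContinuousMap.dist_apply_le_dist _
      have key := abs_response_sub_le hu.rates (θ := x) hL0.le e j
        (hlip j e _ (clamp_mem_cube hε.le _ _ x) _ (clamp_mem_cube hε.le _ _ x))
        ((norm_clamp_sub_le (G.exitTimes u c) ε _ _).trans hdist)
      rwa [← extension_of_mem (ε := ε) (x := Set.IccExtend hle T) hx,
        ← extension_of_mem (ε := ε) (x := Set.IccExtend hle T') hx] at key
  obtain ⟨T, hT⟩ : ∃ T, Φ T = T := ⟨hcontr.fixedPoint, hcontr.fixedPoint_isFixedPt⟩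
  have hag : AgreeUntil c u (ext T) := extension_agree G g u c δ ε (Set.IccExtend hle T)
  refine ⟨c + δ, by linarith, ext T, hrates T, fun e j => ?_⟩
  rw [← Set.Ico_union_Ico_eq_Ico hc.1 hle, ae_restrict_union_iff]
  constructor
  · rw [ae_restrict_iff' measurableSet_Ico]
    filter_upwards [(ae_restrict_iff' measurableSet_Ico).1 (hu.eq_response e j),
      (ae_restrict_iff' measurableSet_Ico).1 (hag e j),
      response_ae_congr hu.rates (hrates T) (g := g) hag e j] with θ h1 h2 h3 hθ
    rw [← h2 hθ, h1 hθ, h3 hθ.2]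
  · rw [ae_restrict_iff' measurableSet_Ico]
    filter_upwards [nodeInflow_ae_congr hu.rates (hrates T) hag (G.tail e) j] with θ h1 hθ
    have hθ' : θ ∈ Set.Icc c (c + δ) := ⟨hθ.1, hθ.2.le⟩
    have h2 : Set.IccExtend hle T θ = G.exitTimes (ext T) θ := by
      rw [Set.IccExtend_of_mem hle _ hθ']
      conv_lhs => rw [← hT]
      rfl
    -- At the fixed point the guess consists of genuine exit times, which stay in the cube; hence
    -- the truncation is inactive and the extension obeys the profile itself.
    have h3 : G.exitTimes (ext T) θ ∈
        Set.Icc (G.exitTimes u c) (fun e => G.exitTimes u c e + ε) := by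
      rw [exitTimes_congr hag le_rfl]
      exact exitTimes_mem_cube (hrates T) hδcube hθ'
    have h4 : max c (min θ (c + ε)) = θ := by
      rw [min_eq_left (by linarith [hθ.2]), max_eq_right hθ.1]
    change G.extension g u c δ ε (Set.IccExtend hle T) e j θ = _
    rw [extension_of_mem hθ, h2, clamp_of_mem h3, h4, response,
      h1 fun e => by linarith [hθ.2, hδτ e]]

/-- Inflow rates that follow a strategy profile until times arbitrarily close to `a` can be glued
together. -/
lemma exists_followsUntil_of_forall_lt
    (hL : ∀ j e, G.RightLipschitz (g j e)) {a : ℝ} (ha : a ∈ Set.Ioc 0 G.H)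
    (h : ∀ c ∈ Set.Ico 0 a, ∃ u, G.FollowsUntil g c u) : ∃ u, G.FollowsUntil g a u := by
  have ha0 := ha.1
  set t : ℕ → ℝ := fun n => a - a / (n + 1) with ht
  have ht0 : ∀ n, t n ∈ Set.Ico 0 a := fun n => by
    refine ⟨?_, ?_⟩
    · rw [ht, sub_nonneg]
      exact div_le_self ha0.le (by linarith [(n.cast_nonneg : (0 : ℝ) ≤ n)])
    · have : 0 < a / (n + 1) := by positivity
      simp only [ht]; linarith
  choose w hw using fun n => h (t n) (ht0 n)
  -- A measurable choice of an index `n` with `θ < t n`, so that gluing needs only countably many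
  -- solutions.
  set N : ℝ → ℕ := fun θ => ⌊a / (a - θ)⌋₊ with hN
  have hNlt : ∀ θ < a, θ < t (N θ) := fun θ hθ => by
    have hpos : 0 < a - θ := sub_pos.2 hθ
    have h1 := Nat.lt_floor_add_one (a / (a - θ))
    rw [div_lt_iff₀ hpos] at h1
    have h2 : a / ((N θ : ℝ) + 1) < a - θ := by
      rw [div_lt_iff₀ (by positivity)]
      linarith
    simp only [ht]; linarith
  have hNm : Measurable N := Nat.measurable_floor.comp (measurable_const.div
    (measurable_const.sub measurable_id))
  let v : E → P → ℝ → ℝ := fun e j θ => if θ < a then w (N θ) e j θ else 0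
  have hv : G.AreRates v := fun e j => by
    refine ⟨?_, fun θ => ?_, fun θ => ?_, fun θ hθ => ?_⟩
    · refine Measurable.ite measurableSet_Iio ?_ measurable_const
      have h1 : Measurable fun p : ℕ × ℝ => w p.1 e j p.2 :=
        measurable_from_prod_countable_right fun n => ((hw n).rates e j).measurable
      exact h1.comp (hNm.prodMk measurable_id)
    · simp only [v]
      split_ifs
      · exact ((hw _).rates e j).nonneg θ
      · exact le_rfl
    · simp only [v]
      split_ifs
      · exact ((hw _).rates e j).le θ
      · exact rateBound_nonneg
    · simp only [v]
      rw [((hw _).rates e j).eq_zero θ hθ, ite_self]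
  -- Independently chosen solutions fit together by uniqueness on the common interval, outside a
  -- countable union of null sets.
  have hvw : ∀ n, AgreeUntil (t n) v (w n) := fun n e j => by
    have h1 : ∀ m, ∀ᵐ θ, θ ∈ Set.Ico 0 (min (t m) (t n)) → w m e j θ = w n e j θ := fun m => by
      rw [← ae_restrict_iff' measurableSet_Ico]
      exact FollowsUntil.agree hL (le_min (ht0 m).1 (ht0 n).1)
        ((min_le_left _ _).trans ((ht0 m).2.le.trans ha.2)) ((hw m).mono (min_le_left _ _))
        ((hw n).mono (min_le_right _ _)) e j
    rw [ae_restrict_iff' measurableSet_Ico]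
    filter_upwards [ae_all_iff.2 h1] with θ hθ hmem
    have hlt : θ < a := hmem.2.trans (ht0 n).2
    simp only [v, if_pos hlt]
    exact hθ _ ⟨hmem.1, lt_min (hNlt θ hlt) hmem.2⟩
  refine ⟨v, hv, fun e j => ae_restrict_Ico_of_forall_lt ha0 fun c hc => ?_⟩
  have hn := hNlt c hc.2
  have hag := hvw (N c)
  refine ae_restrict_of_ae_restrict_of_subset (Set.Ico_subset_Ico_right hn.le) ?_
  rw [ae_restrict_iff' measurableSet_Ico]
  filter_upwards [(ae_restrict_iff' measurableSet_Ico).1 ((hw (N c)).eq_response e j),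
    (ae_restrict_iff' measurableSet_Ico).1 (hag e j),
    response_ae_congr hv (hw (N c)).rates (g := g) hag e j] with θ h1 h2 h3 hθ
  rw [h2 hθ, h1 hθ, h3 hθ.2]

lemma exists_followsUntil (hg : ∀ j, G.IsStrategy j (g j))
    (hL : ∀ j e, G.RightLipschitz (g j e)) : ∃ u, G.FollowsUntil g G.H u := by
  refine continuation (p := fun c => ∃ u, G.FollowsUntil g c u) G.H_pos.le ?_ ?_ ?_ ?_
  · refine ⟨fun _ _ _ => 0, fun e j => ?_, fun e j => by simp⟩
    exact ⟨measurable_const, fun _ => le_rfl, fun _ => rateBound_nonneg, fun _ _ => rfl⟩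
  · rintro x y hxy ⟨u, hu⟩
    exact ⟨u, hu.mono hxy⟩
  · exact fun c hc h => exists_followsUntil_of_forall_lt hL hc h
  · rintro c hc ⟨u, hu⟩
    exact hu.exists_extension hg hL hc

end Game

/-! ### From rates to feasible flows. -/

lemma sum_cumulative {P : Type*} [Fintype P] {r : P → ℝ → ℝ} {θ : ℝ}
    (h : ∀ j, IntegrableOn (r j) (Set.Ioc 0 θ)) :
    ∑ j, cumulative (r j) θ = cumulative (fun x => ∑ j, r j x) θ :=
  (integral_finsetSum _ fun j _ => h j).symm

lemma ae_Ico_shift {b τ : ℝ} {p : ℝ → Prop} (h : ∀ᵐ x ∂volume.restrict (Set.Ico 0 b), p (x + τ)) :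
    ∀ᵐ y, y ∈ Set.Ico τ (b + τ) → p y := by
  have h1 := (measurePreserving_sub_right volume τ).quasiMeasurePreserving.ae
    ((ae_restrict_iff' measurableSet_Ico).1 h)
  filter_upwards [h1] with y hy hmem
  have := hy ⟨by linarith [hmem.1], by linarith [hmem.2]⟩
  rwa [sub_add_cancel] at this

/-- Integrable rates with values in `[0, M]` have an admissible version. -/
lemma exists_isRate {H M : ℝ} (hM : 0 ≤ M) {r : ℝ → ℝ} (hr : IntegrableOn r (Set.Ico 0 H))
    (h0 : ∀ x ∈ Set.Ico 0 H, 0 ≤ r x) (hle : ∀ᵐ x ∂volume.restrict (Set.Ico 0 H), r x ≤ M) :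
    ∃ u, IsRate H M u ∧ ∀ᵐ x ∂volume.restrict (Set.Ico 0 H), r x = u x := by
  set m := hr.aestronglyMeasurable.mk r with hm
  have hmm : Measurable m := hr.aestronglyMeasurable.stronglyMeasurable_mk.measurable
  -- The measurable representative satisfies the bounds only almost everywhere; truncation makes
  -- them hold at every point.
  refine ⟨(Set.Ico 0 H).indicator fun x => max 0 (min (m x) M), ⟨?_, ?_, ?_, ?_⟩, ?_⟩
  · exact (measurable_const.max (hmm.min measurable_const)).indicator measurableSet_Ico
  · exact fun x => Set.indicator_nonneg (fun _ _ => le_max_left _ _) x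
  · intro x
    exact Set.indicator_le' (fun _ _ => max_le hM (min_le_right _ _)) (fun _ _ => hM) x
  · exact fun x hx => Set.indicator_of_notMem hx _
  · filter_upwards [hr.aestronglyMeasurable.ae_eq_mk, hle, ae_restrict_mem measurableSet_Ico]
      with x h1 h2 h3
    rw [Set.indicator_of_mem h3, hm, ← h1, min_eq_left h2, max_eq_right (h0 x h3)]

namespace Game

variable {V E P : Type*} [Fintype E] [Fintype P] {G : Game V E P}
  {g : P → E → ℝ × (E → ℝ) → ℝ} {u : E → P → ℝ → ℝ}

/-- The flow over time with inflow rates `u`. -/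
def flowOf (G : Game V E P) (u : E → P → ℝ → ℝ) : Rates E P where
  inflow := u
  outflow e j := playerOutflow (G.τ e) (G.ν e) (u e) j

lemma queue_flowOf (hu : G.AreRates u) (e : E) (θ : ℝ) :
    G.queue (G.flowOf u) e θ = queueLength (G.ν e) (totalRate (u e)) θ := by
  have h1 : ∑ j, cumulative (u e j) θ = cumulative (totalRate (u e)) θ :=
    sum_cumulative fun j => (hu e j).integrable.integrableOn
  have h2 : ∑ j, cumulative (playerOutflow (G.τ e) (G.ν e) (u e) j) (θ + G.τ e) =
      cumulative (throughput (G.τ e) (G.ν e) (totalRate (u e))) (θ + G.τ e) := by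
    rw [sum_cumulative fun j => integrableOn_playerOutflow (hu e) (G.ν_pos e) j (by simp)]
    exact integral_congr_ae
      (ae_restrict_of_ae (ae_sum_playerOutflow (hu e) (G.ν_pos e) (G.τ_pos e).le))
  simp only [queue, flowOf]
  rw [h1, h2, (IsRate.totalRate (hu e)).cumulative_throughput (G.ν_pos e) (G.τ_pos e).le]
  ring

lemma exitTime_flowOf (hu : G.AreRates u) (e : E) (θ : ℝ) :
    G.exitTime (G.flowOf u) e θ = arrival (G.τ e) (G.ν e) (totalRate (u e)) θ := by
  rw [exitTime, queue_flowOf hu, arrival]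

lemma info_flowOf (hu : G.AreRates u) (θ : ℝ) :
    G.info (G.flowOf u) θ = (θ, G.exitTimes u θ) := by
  rw [info]
  congr 1
  funext e
  exact exitTime_flowOf hu e θ

lemma inflowExt_flowOf (hu : G.AreRates u) (e : E) (j : P) (φ : ℝ) :
    inflowExt (G.flowOf u) e j φ = u e j φ := by
  unfold inflowExt
  split_ifs with h
  · rfl
  · rw [(hu e j).eq_zero φ fun h' => h h'.1]

variable [DecidableEq V]

lemma FollowsUntil.follows_flowOf (hu : G.FollowsUntil g G.H u) : G.Follows g (G.flowOf u) := by
  refine ⟨fun j e he => ?_, fun j e he he' => ?_, fun j e he => ?_⟩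
  · filter_upwards [hu.eq_response e j] with θ hθ
    rw [info_flowOf hu.rates]
    refine hθ.trans ?_
    rw [response, he, if_neg (G.s_ne_t j), nodeInflow, if_pos rfl]
    rfl
  · filter_upwards [hu.eq_response e j] with θ hθ
    rw [info_flowOf hu.rates]
    refine hθ.trans ?_
    rw [response, if_neg he', nodeInflow, if_neg he, add_zero]
    rfl
  · filter_upwards [hu.eq_response e j] with θ hθ
    refine hθ.trans ?_
    rw [response, if_pos he]

/-- Flow conservation. -/
lemma FollowsUntil.ae_sum_outEdges (hg : ∀ j, G.IsStrategy j (g j))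
    (hu : G.FollowsUntil g G.H u) (j : P) {v : V} (hv : v ≠ G.t j) :
    ∀ᵐ θ ∂volume.restrict (Set.Ico 0 G.H), ∑ e ∈ G.outEdges v, u e j θ = G.nodeInflow u v j θ := by
  filter_upwards [ae_all_iff.2 fun e => hu.eq_response e j, ae_restrict_mem measurableSet_Ico]
    with θ hθ hmem
  have h1 : ∀ e ∈ G.outEdges v, u e j θ =
      g j e (θ, G.exitTimes u θ) * G.nodeInflow u v j θ := fun e he => by
    have hev : G.tail e = v := (Finset.mem_filter.1 he).2
    rw [hθ e, response, hev, if_neg hv]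
  rw [Finset.sum_congr rfl h1, ← Finset.sum_mul,
    (hg j).sum_eq_one _ (info_mem hu.rates hmem) v hv, one_mul]

lemma FollowsUntil.isFeasible_flowOf (hg : ∀ j, G.IsStrategy j (g j))
    (hu : G.FollowsUntil g G.H u) : G.IsFeasible (G.flowOf u) where
  inflow_nonneg e j θ _ := (hu.rates e j).nonneg θ
  outflow_nonneg e j θ _ := playerOutflow_nonneg (hu.rates e) (G.ν_pos e) j θ
  inflow_integrable e j := (hu.rates e j).integrable.integrableOn
  outflow_integrable e j := integrableOn_playerOutflow (hu.rates e) (G.ν_pos e) j (by simp)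
  conservation_source j := by
    filter_upwards [hu.ae_sum_outEdges hg j (G.s_ne_t j)] with θ hθ
    rw [nodeInflow, if_pos rfl] at hθ
    exact sub_eq_of_eq_add' hθ
  conservation j v hs ht := by
    filter_upwards [hu.ae_sum_outEdges hg j ht] with θ hθ
    rw [nodeInflow, if_neg hs, add_zero] at hθ
    exact sub_eq_zero.2 hθ
  non_deficit e j θ _ := by
    have := cumulative_playerOutflow_le (hu.rates e) (G.ν_pos e) (G.τ_pos e).le j θ
    exact sub_nonneg.2 this
  capacity e := by
    have h1 := ae_sum_playerOutflow (hu.rates e) (G.ν_pos e) (G.τ_pos e).le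
    have h2 := (measurePreserving_add_right volume (G.τ e)).quasiMeasurePreserving.ae h1
    filter_upwards [ae_restrict_of_ae h2] with θ hθ
    rw [throughput_add, ← queue_flowOf hu.rates] at hθ
    exact hθ
  share e := by
    have hU := IsRate.totalRate (hu.rates e)
    filter_upwards [ae_restrict_of_ae
      (ae_sum_playerOutflow (hu.rates e) (G.ν_pos e) (G.τ_pos e).le),
      ae_restrict_mem measurableSet_Ico] with y hy hmem
    refine ⟨entry (G.τ e) (G.ν e) (totalRate (u e)) y, ⟨⟨?_, ?_⟩, ?_⟩, fun j => ?_⟩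
    · have := hU.entry_le (τ := G.τ e) (G.ν_pos e) y
      linarith [hmem.2]
    · rw [exitTime_flowOf hu.rates]
      exact hU.arrival_entry (G.ν_pos e) y
    · rintro x ⟨-, hx⟩
      rw [exitTime_flowOf hu.rates] at hx
      exact (hU.isGreatest_entry (G.ν_pos e) y).2 hx
    · simp only [inflowExt_flowOf hu.rates]
      change playerOutflow _ _ _ _ _ = if 0 < totalRate (u e) _ then
        _ / totalRate (u e) _ * ∑ i, playerOutflow (G.τ e) (G.ν e) (u e) i y else 0
      rw [hy]
      split_ifs with h
      · rfl
      · have h0 : totalRate (u e) (entry (G.τ e) (G.ν e) (totalRate (u e)) y) = 0 :=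
          le_antisymm (not_lt.1 h) (hU.nonneg _)
        -- The convention `x / 0 = 0` reproduces the second branch of fluid merging.
        rw [playerOutflow, h0, div_zero, zero_mul]

/-! ### Every feasible flow is determined by its inflow rates. -/

section Uniqueness

variable {f : Rates E P}

lemma IsFeasible.queue_nonneg (hf : G.IsFeasible f) (e : E) {θ : ℝ} (hθ : θ ∈ Set.Ico 0 G.H) :
    0 ≤ G.queue f e θ := by
  rw [queue, ← Finset.sum_sub_distrib]
  exact Finset.sum_nonneg fun j _ => hf.non_deficit e j θ hθ

lemma IsFeasible.le_exitTime (hf : G.IsFeasible f) (e : E) {θ : ℝ} (hθ : θ ∈ Set.Ico 0 G.H) :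
    θ + G.τ e ≤ G.exitTime f e θ := by
  have := div_nonneg (hf.queue_nonneg e hθ) (G.ν_pos e).le
  unfold exitTime
  linarith

lemma IsFeasible.info_mem (hf : G.IsFeasible f) {θ : ℝ} (hθ : θ ∈ Set.Ico 0 G.H) :
    G.info f θ ∈ G.infoSet :=
  ⟨hθ, fun e => by
    have h1 := hf.le_exitTime e hθ
    have h2 := G.τ_pos e
    have h3 := hθ.1
    simp only [info]
    linarith⟩

/-- No flow leaves an edge before the transit time has elapsed. -/
lemma IsFeasible.ae_outflow_eq_zero (hf : G.IsFeasible f) (e : E) :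
    ∀ᵐ y ∂volume.restrict (Set.Ico 0 (G.τ e)), ∀ j, f.outflow e j y = 0 := by
  have hsub : Set.Ico 0 (G.τ e) ⊆ Set.Ico 0 (G.H + G.τ e) :=
    Set.Ico_subset_Ico_right (by linarith [G.H_pos])
  filter_upwards [ae_restrict_of_ae_restrict_of_subset hsub (hf.share e),
    ae_restrict_mem measurableSet_Ico] with y ⟨φ, hφ, h⟩ hy j
  -- An exit before `τ` would require entrance at a negative time, where the extended inflow is `0`.
  have hneg : ¬ 0 ≤ φ := fun h0 => by
    have h1 := hf.le_exitTime e (θ := φ) ⟨h0, hφ.1.1⟩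
    rw [hφ.1.2] at h1
    linarith [hy.2]
  rw [h j, if_neg]
  simp [inflowExt, hneg]

lemma IsFeasible.ae_sum_outflow_le (hf : G.IsFeasible f) (e : E) :
    ∀ᵐ y, y ∈ Set.Ico 0 (G.H + G.τ e) → ∑ j, f.outflow e j y ≤ G.ν e := by
  have h1 : ∀ᵐ x ∂volume.restrict (Set.Ico 0 G.H),
      ∑ j, f.outflow e j (x + G.τ e) ≤ G.ν e := by
    filter_upwards [hf.capacity e] with x hx
    rw [hx]
    split_ifs
    · exact le_rfl
    · exact min_le_right _ _
  have h2 := ae_Ico_shift (p := fun y => ∑ j, f.outflow e j y ≤ G.ν e) h1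
  filter_upwards [h2, (ae_restrict_iff' measurableSet_Ico).1 (hf.ae_outflow_eq_zero e)]
    with y hy1 hy2 hy
  rcases lt_or_ge y (G.τ e) with h | h
  · rw [Finset.sum_eq_zero fun j _ => hy2 ⟨hy.1, h⟩ j]
    exact (G.ν_pos e).le
  · exact hy1 ⟨h, hy.2⟩

lemma IsFeasible.ae_outflow_le (hf : G.IsFeasible f) (e : E) :
    ∀ᵐ y, y ∈ Set.Ico 0 (G.H + G.τ e) → ∀ j, f.outflow e j y ≤ G.ν e := by
  filter_upwards [hf.ae_sum_outflow_le e] with y hy hmem j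
  exact (Finset.single_le_sum (f := fun i => f.outflow e i y)
    (fun i _ => hf.outflow_nonneg e i y hmem) (Finset.mem_univ j)).trans (hy hmem)

/-- The inflow rates of a feasible flow that follows a strategy profile are bounded. -/
lemma IsFeasible.ae_inflow_le (hg : ∀ j, G.IsStrategy j (g j)) (hf : G.IsFeasible f)
    (hfg : G.Follows g f) (e : E) (j : P) :
    ∀ᵐ θ ∂volume.restrict (Set.Ico 0 G.H), f.inflow e j θ ≤ G.rateBound := by
  have hout : ∀ᵐ θ ∂volume.restrict (Set.Ico 0 G.H), ∀ e,
      0 ≤ f.outflow e j θ ∧ f.outflow e j θ ≤ G.ν e := by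
    rw [ae_restrict_iff' measurableSet_Ico]
    filter_upwards [ae_all_iff.2 hf.ae_outflow_le] with θ hθ hmem e
    have hmem' : θ ∈ Set.Ico 0 (G.H + G.τ e) := ⟨hmem.1, by linarith [hmem.2, G.τ_pos e]⟩
    exact ⟨hf.outflow_nonneg e j θ hmem', hθ e hmem' j⟩
  by_cases hs : G.tail e = G.s j
  · filter_upwards [hfg.source j e hs, hout, ae_restrict_mem measurableSet_Ico] with θ h1 h2 hmem
    have hsum := sum_add_supply_le (G := G) (G.s j) j fun e => (h2 e).2
    rw [if_pos rfl] at hsum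
    rw [h1]
    refine (mul_le_of_le_one_left ?_ ((hg j).mem_Icc e _ (hf.info_mem hmem)).2).trans hsum
    exact add_nonneg (Finset.sum_nonneg fun e _ => (h2 e).1) (G.d_pos j).le
  by_cases ht : G.tail e = G.t j
  · filter_upwards [hfg.sink j e ht] with θ h1
    rw [h1]; exact rateBound_nonneg
  · filter_upwards [hfg.inner j e hs ht, hout, ae_restrict_mem measurableSet_Ico] with θ h1 h2 hmem
    have hsum := sum_add_supply_le (G := G) (G.tail e) j fun e => (h2 e).2
    rw [if_neg hs, add_zero] at hsum
    rw [h1]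
    refine (mul_le_of_le_one_left ?_ ((hg j).mem_Icc e _ (hf.info_mem hmem)).2).trans hsum
    exact Finset.sum_nonneg fun e _ => (h2 e).1

/-- The queues of a feasible flow are determined by its inflow rates. -/
lemma IsFeasible.queue_eq (hf : G.IsFeasible f) (hu : G.AreRates u)
    (h : AgreeUntil G.H f.inflow u) (e : E) {θ : ℝ} (hθ : θ ∈ Set.Ico 0 G.H) :
    G.queue f e θ = queueLength (G.ν e) (totalRate (u e)) θ := by
  have hτ := G.τ_pos e
  have hint : IntegrableOn (fun y => ∑ j, f.outflow e j y) (Set.Ico 0 (G.H + G.τ e)) :=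
    integrable_finsetSum _ fun j _ => hf.outflow_integrable e j
  have htot : ∀ᵐ x ∂volume.restrict (Set.Ico 0 G.H),
      totalRate (f.inflow e) x = totalRate (u e) x := totalRate_ae_congr (h e)
  refine (IsRate.totalRate (hu e)).queueLength_unique (b := G.H)
    (w := fun x => ∑ j, f.outflow e j (x + G.τ e)) ?_ ?_ (fun θ hθ => hf.queue_nonneg e hθ)
    ?_ ?_ hθ
  · have h1 := (measurePreserving_add_right volume (G.τ e)).integrableOn_comp_preimage
      (measurableEmbedding_addRight (G.τ e)) (f := fun y => ∑ j, f.outflow e j y)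
      (s := Set.Ico (G.τ e) (G.H + G.τ e))
    rw [Set.preimage_add_const_Ico, sub_self, add_sub_cancel_right] at h1
    exact h1.2 (hint.mono_set (Set.Ico_subset_Ico_left hτ.le))
  · intro θ hθ
    have hsub : Set.Ioc 0 θ ⊆ Set.Ico 0 G.H := fun x hx => ⟨hx.1.le, hx.2.trans_lt hθ.2⟩
    have hsub' : Set.Ioc 0 (θ + G.τ e) ⊆ Set.Ico 0 (G.H + G.τ e) := fun x hx =>
      ⟨hx.1.le, by linarith [hx.2, hθ.2]⟩
    rw [queue, sum_cumulative fun j => (hf.inflow_integrable e j).mono_set hsub,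
      sum_cumulative fun j => (hf.outflow_integrable e j).mono_set hsub',
      cumulative_shift ?_ hτ.le hθ.1 (hint.mono_set hsub')]
    · congr 1
      exact IsRate.cumulative_congr htot hθ.2.le
    · filter_upwards [hf.ae_outflow_eq_zero e] with y hy
      exact Finset.sum_eq_zero fun j _ => hy j
  · filter_upwards [hf.capacity e] with x hx
    rw [hx]
    split_ifs
    · exact le_rfl
    · exact min_le_right _ _
  · filter_upwards [hf.capacity e] with x hx hpos
    rw [hx, if_pos hpos]

/-- The outflow rates of a feasible flow are determined by its inflow rates. -/
lemma IsFeasible.ae_outflow_eq (hf : G.IsFeasible f) (hu : G.AreRates u)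
    (h : AgreeUntil G.H f.inflow u) (e : E) :
    ∀ᵐ y, y ∈ Set.Ico 0 (G.H + G.τ e) →
      ∀ j, f.outflow e j y = playerOutflow (G.τ e) (G.ν e) (u e) j y := by
  have hU := IsRate.totalRate (hu e)
  have hin : ∀ᵐ x, x ∈ Set.Ico 0 G.H → ∀ i, f.inflow e i x = u e i x := by
    rw [← ae_restrict_iff' measurableSet_Ico]
    exact ae_all_iff.2 (h e)
  have hsum : ∀ᵐ x ∂volume.restrict (Set.Ico 0 G.H), ∑ j, f.outflow e j (x + G.τ e) =
      throughput (G.τ e) (G.ν e) (totalRate (u e)) (x + G.τ e) := by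
    rw [ae_restrict_iff' measurableSet_Ico]
    filter_upwards [(ae_restrict_iff' measurableSet_Ico).1 (hf.capacity e), hin] with x h1 h2 hx
    rw [h1 hx, throughput_add, hf.queue_eq hu h e hx,
      Finset.sum_congr rfl fun i _ => h2 hx i]
    rfl
  have hsum' := ae_Ico_shift (p := fun y => ∑ j, f.outflow e j y =
      throughput (G.τ e) (G.ν e) (totalRate (u e)) y) hsum
  filter_upwards [(ae_restrict_iff' measurableSet_Ico).1 (hf.ae_outflow_eq_zero e), hsum',
    (ae_restrict_iff' measurableSet_Ico).1 (hf.share e),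
    hU.ae_entry (τ := G.τ e) (G.ν_pos e) hin] with y h1 h2 h3 h4 hy j
  rcases lt_or_ge y (G.τ e) with hlt | hge
  · rw [h1 ⟨hy.1, hlt⟩ j, playerOutflow_of_lt (hu e) (G.ν_pos e) j hlt]
  obtain ⟨φ, ⟨⟨hφH, hφy⟩, hφmax⟩, hφ⟩ := h3 hy
  set ψ := entry (G.τ e) (G.ν e) (totalRate (u e)) y with hψ
  have hexit : ∀ x ∈ Set.Ico 0 G.H,
      G.exitTime f e x = arrival (G.τ e) (G.ν e) (totalRate (u e)) x := fun x hx => by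
    rw [exitTime, hf.queue_eq hu h e hx, arrival]
  -- The two exit time functions are known to agree only on `[0, H)`. Since `τ ≤ y < H + τ`, the
  -- time `ψ` lies there; comparing the two maximality properties then identifies it with `φ`.
  have hψ0 : 0 ≤ ψ := by
    rw [hψ, ← hU.arrival_le_iff (G.ν_pos e), hU.arrival_of_nonpos le_rfl]
    linarith
  have hψH : ψ < G.H := by
    have := hU.entry_le (τ := G.τ e) (G.ν_pos e) y
    linarith [hy.2]
  have hle : ψ ≤ φ := hφmax ⟨hψH, by
    rw [hexit ψ ⟨hψ0, hψH⟩]; exact hU.arrival_entry (G.ν_pos e) y⟩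
  have hφψ : φ = ψ := by
    refine le_antisymm ((hU.isGreatest_entry (G.ν_pos e) y).2 ?_) hle
    rw [hexit φ ⟨hψ0.trans hle, hφH⟩] at hφy
    exact hφy
  have hext : ∀ i, inflowExt f e i φ = u e i ψ := fun i => by
    rw [hφψ, inflowExt, if_pos hψ0, h4 ⟨hψ0, hψH⟩ i]
  rw [hφ j, h2 ⟨hge, hy.2⟩, playerOutflow]
  simp only [hext]
  change (if 0 < totalRate (u e) ψ then u e j ψ / totalRate (u e) ψ * _ else 0) = _
  split_ifs with hpos
  · rfl
  · have h0 : totalRate (u e) ψ = 0 := le_antisymm (not_lt.1 hpos) (hU.nonneg _)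
    rw [← hψ, h0, div_zero, zero_mul]

lemma IsFeasible.followsUntil (hf : G.IsFeasible f) (hfg : G.Follows g f) (hu : G.AreRates u)
    (h : AgreeUntil G.H f.inflow u) : G.FollowsUntil g G.H u := by
  refine ⟨hu, fun e j => ?_⟩
  have hinfo : ∀ θ ∈ Set.Ico 0 G.H, G.info f θ = (θ, G.exitTimes u θ) := fun θ hθ => by
    rw [info]
    congr 1
    funext e
    rw [exitTime, hf.queue_eq hu h e hθ]
    rfl
  have hout : ∀ᵐ θ ∂volume.restrict (Set.Ico 0 G.H), ∀ e,
      f.outflow e j θ = playerOutflow (G.τ e) (G.ν e) (u e) j θ := by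
    rw [ae_restrict_iff' measurableSet_Ico]
    filter_upwards [ae_all_iff.2 fun e => hf.ae_outflow_eq hu h e] with θ hθ hmem e
    exact hθ e ⟨hmem.1, by linarith [hmem.2, G.τ_pos e]⟩ j
  unfold response nodeInflow
  by_cases hs : G.tail e = G.s j
  · filter_upwards [hfg.source j e hs, hout, h e j, ae_restrict_mem measurableSet_Ico]
      with θ h1 h2 h3 hmem
    rw [← h3, h1, hinfo θ hmem, hs, if_neg (G.s_ne_t j), if_pos rfl,
      Finset.sum_congr rfl fun e _ => h2 e]
  by_cases ht : G.tail e = G.t j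
  · filter_upwards [hfg.sink j e ht, h e j] with θ h1 h3
    rw [← h3, h1, if_pos ht]
  · filter_upwards [hfg.inner j e hs ht, hout, h e j, ae_restrict_mem measurableSet_Ico]
      with θ h1 h2 h3 hmem
    rw [← h3, h1, hinfo θ hmem, if_neg ht, if_neg hs, add_zero,
      Finset.sum_congr rfl fun e _ => h2 e]

end Uniqueness

end Game

end FlowOverTime

end

theorem theorem2 {V E P : Type*} [Fintype V] [DecidableEq V] [Fintype E] [Fintype P]
    (G : FlowOverTime.Game V E P) (g : P → E → ℝ × (E → ℝ) → ℝ)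
    (hg : ∀ j, G.IsStrategy j (g j)) (hL : ∀ j e, G.RightLipschitz (g j e)) :
    ∃ f : FlowOverTime.Rates E P, (G.IsFeasible f ∧ G.Follows g f) ∧
      ∀ f' : FlowOverTime.Rates E P, G.IsFeasible f' → G.Follows g f' →
        (∀ e j, f'.inflow e j =ᵐ[volume.restrict (Set.Ico 0 G.H)] f.inflow e j) ∧
        (∀ e j, f'.outflow e j =ᵐ[volume.restrict (Set.Ico 0 (G.H + G.τ e))] f.outflow e j) := by
  obtain ⟨u, hu⟩ := FlowOverTime.Game.exists_followsUntil hg hL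
  refine ⟨G.flowOf u, ⟨hu.isFeasible_flowOf hg, hu.follows_flowOf⟩, fun f hf hfg => ?_⟩
  -- A competing flow is replaced by a version with rates bounded everywhere, to which uniqueness of
  -- rates applies. Its outflow then agrees because it is a function of the inflow.
  choose u' hu' hfu' using fun e j => FlowOverTime.exists_isRate
    FlowOverTime.Game.rateBound_nonneg (hf.inflow_integrable e j) (hf.inflow_nonneg e j)
    (hf.ae_inflow_le hg hfg e j)
  have hagree := (hf.followsUntil hfg hu' hfu').agree hL G.H_pos.le le_rfl hu
  refine ⟨fun e j => ?_, fun e j => ?_⟩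
  · filter_upwards [hfu' e j, hagree e j] with θ h1 h2
    exact h1.trans h2
  · have h1 := FlowOverTime.playerOutflow_ae_congr (τ := G.τ e) (hu' e) (hu.rates e) (G.ν_pos e)
      (hagree e) j
    rw [Filter.EventuallyEq, ae_restrict_iff' measurableSet_Ico]
    filter_upwards [h1, hf.ae_outflow_eq hu' hfu' e] with y h2 h3 hy
    exact (h3 hy j).trans (h2 hy.2)
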